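/- Let $n\ge 2$ and let $(M,g)$ be a smooth connected Riemannian manifold of dimension $2n$ with Levi-Civita connection $\nabla$, Ricci tensor $\rho$ and scalar curvature $\tau=\operatorname{tr}_g\rho$. Suppose that at every point $x\in M$ the Ricci tensor has exactly two distinct eigenvalues $\lambda_0(x)$ and $\mu_0(x)$ with respect to $g$, of multiplicity $2$ and $2(n-1)$ respectively. Let $\mathcal D$ and $\mathcal D^{\perp}$ be the eigendistributions corresponding to $\lambda_0$ and $\mu_0$ (smooth distributions on $M$). Assume that $\mathcal D$ is a totally geodesic foliation, i.e. $[X,Y]\in\Gamma(\mathcal D)$ and $\nabla_XY\in\Gamma(\mathcal D)$ for all local sections $X,Y\in\Gamma(\mathcal D)$, and that $\mathcal D^{\perp}$ is umbilical, i.e. there is a vector field $\xi$ orthogonal to $\mathcal D^{\perp}$ such that for every local section $X\in\Gamma(\mathcal D^{\perp})$ the component of $\nabla_XX$ orthogonal to $\mathcal D^{\perp}$ equals $g(X,X)\,\xi$. Then $(M,g)$ is a Gray manifold if and only if the function $\lambda_0-2\mu_0$ is constant and the gradient $\nabla\tau$ is a section of $\mathcal D$. Here $(M,g)$ is called a Gray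 manifold if $S=\rho-\frac{2\tau}{\dim M+2}\,g=\rho-\frac{\tau}{n+1}\,g$, regarded as an endomorphism of $TM$ by means of $g$, is a Killing tensor, i.e. $g(SX,Y)=g(X,SY)$ and $g((\nabla_XS)X,X)=0$ for all $X,Y\in TM$. -/

import Mathlib

open Bundle Manifold VectorField Module
open scoped ContDiff Topology InnerProductSpace

noncomputable section
namespace GrayManifold

section Connection

variable {E : Type*} [NormedAddCommGroup E] [NormedSpace ℝ E] [FiniteDimensional ℝ E]
  {H : Type*} [TopologicalSpace H] {I : ModelWithCorners ℝ E H}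
  {M : Type*} [TopologicalSpace M] [ChartedSpace H M] [IsManifold I ∞ M]
  [RiemannianBundle (fun x : M ↦ TangentSpace I x)]
  [IsContMDiffRiemannianBundle I ∞ E (fun x : M ↦ TangentSpace I x)]

/-- The Koszul expression: half of
`X g(Y, Z) + Y g(Z, X) - Z g(X, Y) + g([X, Y], Z) - g([X, Z], Y) - g([Y, Z], X)`. -/
def koszulForm (Y X Z : Π x : M, TangentSpace I x) (x : M) : ℝ :=
  (1 / 2) * (d% (fun y ↦ ⟪Y y, Z y⟫_ℝ) x (X x) + d% (fun y ↦ ⟪Z y, X y⟫_ℝ) x (Y x)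
    - d% (fun y ↦ ⟪X y, Y y⟫_ℝ) x (Z x)
    + ⟪mlieBracket I X Y x, Z x⟫_ℝ - ⟪mlieBracket I X Z x, Y x⟫_ℝ - ⟪mlieBracket I Y Z x, X x⟫_ℝ)

/-- Inner products of differentiable vector fields are differentiable. -/
theorem mdifferentiableAt_inner {x : M} {X Y : Π x : M, TangentSpace I x}
    (hX : MDiffAt (T% X) x) (hY : MDiffAt (T% Y) x) :
    MDiffAt (fun y ↦ ⟪X y, Y y⟫_ℝ) x :=
  MDifferentiableAt.inner_bundle (E := fun y : M ↦ TangentSpace I y) hX hY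

theorem koszulForm_tensorial_left {x : M} {Y Z : Π x : M, TangentSpace I x}
    (hY : MDiffAt (T% Y) x) (hZ : MDiffAt (T% Z) x) :
    TensorialAt I E (koszulForm Y · Z x) x where
  smul {f X} hf hX := by
    have h1 := mvfderiv_fun_mul hf (mdifferentiableAt_inner hZ hX)
    have h2 := mvfderiv_fun_mul hf (mdifferentiableAt_inner hX hY)
    simp [koszulForm, mlieBracket_smul_left hf hX, inner_add_left, inner_smul_left, inner_smul_right,
      h1, h2]
    rw [real_inner_comm (X x) (Z x)]
    ring
  add {X X'} hX hX' := by
    have h1 := mvfderiv_fun_add (mdifferentiableAt_inner hZ hX) (mdifferentiableAt_inner hZ hX')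
    have h2 := mvfderiv_fun_add (mdifferentiableAt_inner hX hY) (mdifferentiableAt_inner hX' hY)
    simp [koszulForm, mlieBracket_add_left hX hX', inner_add_left, inner_add_right, h1, h2]
    ring

theorem koszulForm_tensorial_right {x : M} {Y X : Π x : M, TangentSpace I x}
    (hY : MDiffAt (T% Y) x) (hX : MDiffAt (T% X) x) :
    TensorialAt I E (koszulForm Y X · x) x where
  smul {f Z} hf hZ := by
    have h1 := mvfderiv_fun_mul hf (mdifferentiableAt_inner hY hZ)
    have h2 := mvfderiv_fun_mul hf (mdifferentiableAt_inner hZ hX)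
    simp [koszulForm, mlieBracket_smul_right hf hZ, inner_add_left, inner_smul_left,
      inner_smul_right, h1, h2]
    rw [real_inner_comm (X x) (Z x), real_inner_comm (Y x) (Z x)]
    ring
  add {Z Z'} hZ hZ' := by
    have h1 := mvfderiv_fun_add (mdifferentiableAt_inner hY hZ) (mdifferentiableAt_inner hY hZ')
    have h2 := mvfderiv_fun_add (mdifferentiableAt_inner hZ hX) (mdifferentiableAt_inner hZ' hX)
    simp [koszulForm, mlieBracket_add_right hZ hZ', inner_add_left, inner_add_right, h1, h2]
    ring

open scoped Classical in
/-- The Koszul expression as a bilinear form in `(X x, Z x)`, for `Y` differentiable at `x`. -/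
def koszulTensor (Y : Π x : M, TangentSpace I x) (x : M) :
    TangentSpace I x →L[ℝ] TangentSpace I x →L[ℝ] ℝ :=
  if hY : MDiffAt (T% Y) x then
    TensorialAt.mkHom₂ (koszulForm Y · · x) x (fun _ hZ ↦ koszulForm_tensorial_left hY hZ)
      (fun _ hX ↦ koszulForm_tensorial_right hY hX)
  else 0

instance finiteDimensional_tangentSpace (x : M) :
    FiniteDimensional ℝ (TangentSpace I x) :=
  inferInstanceAs (FiniteDimensional ℝ E)

/-- `∇ Y` at `x`: the endomorphism `v ↦ ∇_v Y` given by the Koszul formula. -/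
def leviCivitaFun (Y : Π x : M, TangentSpace I x) (x : M) :
    TangentSpace I x →L[ℝ] TangentSpace I x :=
  have : CompleteSpace (TangentSpace I x) := FiniteDimensional.complete ℝ _
  InnerProductSpace.continuousLinearMapOfBilin (𝕜 := ℝ) (koszulTensor Y x)

theorem inner_leviCivitaFun {x : M} {X Y Z : Π x : M, TangentSpace I x}
    (hX : MDiffAt (T% X) x) (hY : MDiffAt (T% Y) x) (hZ : MDiffAt (T% Z) x) :
    ⟪leviCivitaFun Y x (X x), Z x⟫_ℝ = koszulForm Y X Z x := by
  have : CompleteSpace (TangentSpace I x) := FiniteDimensional.complete ℝ _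
  rw [leviCivitaFun, InnerProductSpace.continuousLinearMapOfBilin_apply, koszulTensor, dif_pos hY]
  exact TensorialAt.mkHom₂_apply _ _ hX hZ

theorem leviCivitaFun_ext {x : M} {L L' : TangentSpace I x →L[ℝ] TangentSpace I x}
    (h : ∀ X Z : Π x : M, TangentSpace I x, MDiffAt (T% X) x → MDiffAt (T% Z) x →
      ⟪L (X x), Z x⟫_ℝ = ⟪L' (X x), Z x⟫_ℝ) : L = L' := by
  ext v
  refine ext_inner_right ℝ fun w ↦ ?_
  have := h (FiberBundle.extend E v) (FiberBundle.extend E w)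
    (FiberBundle.mdifferentiableAt_extend ..) (FiberBundle.mdifferentiableAt_extend ..)
  simpa using this

/-- The Levi-Civita connection; `leviCivita Y x v` is `∇_v Y`. -/
def leviCivita : CovariantDerivative I E (TangentSpace I : M → Type _) where
  toFun := leviCivitaFun
  isCovariantDerivativeOnUniv :=
    { add := by
        intro Y Y' x hY hY' _
        refine leviCivitaFun_ext fun X Z hX hZ ↦ ?_
        have h1 := mvfderiv_fun_add (mdifferentiableAt_inner hY hZ) (mdifferentiableAt_inner hY' hZ)
        have h2 := mvfderiv_fun_add (mdifferentiableAt_inner hX hY) (mdifferentiableAt_inner hX hY')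
        rw [inner_leviCivitaFun hX (mdifferentiableAt_add_section hY hY') hZ,
          add_apply, inner_add_left,
          inner_leviCivitaFun hX hY hZ, inner_leviCivitaFun hX hY' hZ]
        simp [koszulForm, mlieBracket_add_right hY hY', mlieBracket_add_left hY hY',
          inner_add_left, inner_add_right, h1, h2]
        ring
      leibniz := by
        intro Y f x hY hf _
        refine leviCivitaFun_ext fun X Z hX hZ ↦ ?_
        have h1 := mvfderiv_fun_mul hf (mdifferentiableAt_inner hY hZ)
        have h2 := mvfderiv_fun_mul hf (mdifferentiableAt_inner hX hY)
        rw [inner_leviCivitaFun hX (hf.smul_section hY) hZ,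
          add_apply, inner_add_left, smul_apply,
          inner_smul_left, inner_leviCivitaFun hX hY hZ]
        simp [koszulForm, mlieBracket_smul_right hf hY, mlieBracket_smul_left hf hY,
          inner_add_left, inner_smul_left, inner_smul_right, h1, h2]
        rw [real_inner_comm (Y x) (X x)]
        ring }

/-- The connection `leviCivita` is torsion-free. -/
theorem leviCivita_torsion :
    (leviCivita : CovariantDerivative I E (TangentSpace I : M → Type _)).torsion = 0 := by
  rw [CovariantDerivative.torsion_eq_zero_iff]
  intro X Y x hX hY
  refine ext_inner_right ℝ fun w ↦ ?_
  have hZ := FiberBundle.mdifferentiableAt_extend I E w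
  have h1 := inner_leviCivitaFun hX hY hZ
  have h2 := inner_leviCivitaFun hY hX hZ
  have hw : FiberBundle.extend E w x = w := by simp
  rw [inner_sub_left]
  have e1 : ⟪leviCivita Y x (X x), FiberBundle.extend E w x⟫_ℝ = _ := h1
  have e2 : ⟪leviCivita X x (Y x), FiberBundle.extend E w x⟫_ℝ = _ := h2
  rw [hw] at e1 e2
  rw [e1, e2, koszulForm, koszulForm]
  simp only [hw]
  rw [mlieBracket_swap_apply (V := Y) (W := X), inner_neg_left]
  simp only [real_inner_comm]
  ring

/-- The connection `leviCivita` is metric. -/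
theorem leviCivita_metric {x : M} {X Y Z : Π x : M, TangentSpace I x}
    (hX : MDiffAt (T% X) x) (hY : MDiffAt (T% Y) x) (hZ : MDiffAt (T% Z) x) :
    d% (fun y ↦ ⟪Y y, Z y⟫_ℝ) x (X x) =
      ⟪leviCivita Y x (X x), Z x⟫_ℝ + ⟪Y x, leviCivita Z x (X x)⟫_ℝ := by
  have h1 := inner_leviCivitaFun hX hY hZ
  have h2 := inner_leviCivitaFun hX hZ hY
  have e1 : ⟪leviCivita Y x (X x), Z x⟫_ℝ = _ := h1
  have e2 : ⟪Y x, leviCivita Z x (X x)⟫_ℝ = _ := (real_inner_comm _ _).trans h2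
  rw [e1, e2, koszulForm, koszulForm]
  rw [mlieBracket_swap_apply (V := Z) (W := Y), inner_neg_left]
  simp only [real_inner_comm]
  ring

/-- The vector field `∇_X Y`. -/
def nabla (X Y : Π x : M, TangentSpace I x) : Π x : M, TangentSpace I x :=
  fun x ↦ leviCivita Y x (X x)

end Connection

section Curvature

variable {E : Type*} [NormedAddCommGroup E] [NormedSpace ℝ E] [FiniteDimensional ℝ E]
  {H : Type*} [TopologicalSpace H] {I : ModelWithCorners ℝ E H}
  {M : Type*} [TopologicalSpace M] [ChartedSpace H M] [IsManifold I ∞ M]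
  [RiemannianBundle (fun x : M ↦ TangentSpace I x)]
  [IsContMDiffRiemannianBundle I ∞ E (fun x : M ↦ TangentSpace I x)]

/-- `R(X, Y) Z = ∇_X ∇_Y Z - ∇_Y ∇_X Z - ∇_[X, Y] Z` for vector fields `X`, `Y`, `Z`. -/
def curvatureOp (X Y Z : Π x : M, TangentSpace I x) : Π x : M, TangentSpace I x :=
  nabla X (nabla Y Z) - nabla Y (nabla X Z) - nabla (mlieBracket I X Y) Z

/-- The curvature tensor `R(u, v) w` on tangent vectors at `x`. By tensoriality it may be computed
with any smooth local extensions; `FiberBundle.extend` is smooth near `x`. -/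
def curvature (x : M) (u v w : TangentSpace I x) : TangentSpace I x :=
  curvatureOp (FiberBundle.extend E u) (FiberBundle.extend E v) (FiberBundle.extend E w) x

/-- The Ricci tensor `ρ(u, v)`, the trace of `z ↦ R(z, u) v`, in an orthonormal basis. -/
def ricci (x : M) (u v : TangentSpace I x) : ℝ :=
  ∑ i, ⟪curvature x (stdOrthonormalBasis ℝ (TangentSpace I x) i) u v,
    stdOrthonormalBasis ℝ (TangentSpace I x) i⟫_ℝ

/-- The Ricci endomorphism `S₀` of `T_x M`, with `⟪S₀ u, v⟫ = ρ(u, v)`: it sends each vector `e_i`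
of an orthonormal basis to `∑ j, ρ(e_i, e_j) e_j`. -/
def ricciEndo (x : M) : TangentSpace I x →ₗ[ℝ] TangentSpace I x :=
  (stdOrthonormalBasis ℝ (TangentSpace I x)).toBasis.constr ℝ fun i ↦
    ∑ j, ricci x (stdOrthonormalBasis ℝ (TangentSpace I x) i)
      (stdOrthonormalBasis ℝ (TangentSpace I x) j) • stdOrthonormalBasis ℝ (TangentSpace I x) j

variable (I) in
/-- The scalar curvature `τ = tr_g ρ`. -/
def scalarCurvature (x : M) : ℝ :=
  LinearMap.trace ℝ (TangentSpace I x) (ricciEndo x)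

variable (I) in
/-- The gradient `∇f`, determined by `⟪∇f, X⟫ = df(X)`. -/
def grad (f : M → ℝ) (x : M) : TangentSpace I x :=
  have : CompleteSpace (TangentSpace I x) := FiniteDimensional.complete ℝ _
  (InnerProductSpace.toDual ℝ (TangentSpace I x)).symm (mvfderiv I f x)

/-- The covariant derivative `∇S(u, v) = (∇_u S) v = ∇_u (S V) - S (∇_u V)` of a smooth field `S` of
endomorphisms, where `V` is a smooth local extension of `v`. -/
def covDerivEndo (S : Π x : M, TangentSpace I x →ₗ[ℝ] TangentSpace I x) (x : M)
    (u v : TangentSpace I x) : TangentSpace I x :=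
  leviCivita (fun y ↦ S y (FiberBundle.extend E v y)) x u
    - S x (leviCivita (FiberBundle.extend E v) x u)

/-- A (smooth) field `S` of endomorphisms of the tangent bundle is a Killing tensor if it is
symmetric and `g(∇S(X, X), X) = 0` for all tangent vectors `X`. -/
def IsKillingTensor (S : Π x : M, TangentSpace I x →ₗ[ℝ] TangentSpace I x) : Prop :=
  (∀ (x : M) (u v : TangentSpace I x), ⟪S x u, v⟫_ℝ = ⟪u, S x v⟫_ℝ) ∧
    ∀ (x : M) (u : TangentSpace I x), ⟪covDerivEndo S x u u, u⟫_ℝ = 0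

variable (I M) in
/-- `(M, g)` is a Gray manifold if `ρ - 2 τ / (dim M + 2) g` is a Killing tensor. -/
def IsGray : Prop :=
  IsKillingTensor fun x : M ↦
    ricciEndo (I := I) x - (2 * scalarCurvature I x / (finrank ℝ E + 2)) • LinearMap.id

end Curvature

section Distribution

variable {E : Type*} [NormedAddCommGroup E] [NormedSpace ℝ E]
  {H : Type*} [TopologicalSpace H] {I : ModelWithCorners ℝ E H}
  {M : Type*} [TopologicalSpace M] [ChartedSpace H M] [IsManifold I ∞ M]

/-- `D` is a smooth distribution: near every point it has a smooth local frame. -/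
def IsSmoothDistribution (D : Π x : M, Submodule ℝ (TangentSpace I x)) : Prop :=
  ∀ x : M, ∃ U : Set M, IsOpen U ∧ x ∈ U ∧ ∃ (k : ℕ) (X : Fin k → Π y : M, TangentSpace I y),
    (∀ i, CMDiff[U] ∞ (T% (X i))) ∧
      ∀ y ∈ U, LinearIndependent ℝ (fun i ↦ X i y) ∧
        Submodule.span ℝ (Set.range fun i ↦ X i y) = D y

/-- `X` is a smooth section of `D` over the set `U`. -/
def IsSectionOn (D : Π x : M, Submodule ℝ (TangentSpace I x)) (U : Set M)
    (X : Π x : M, TangentSpace I x) : Prop :=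
  CMDiff[U] ∞ (T% X) ∧ ∀ x ∈ U, X x ∈ D x

variable [FiniteDimensional ℝ E]
  [RiemannianBundle (fun x : M ↦ TangentSpace I x)]
  [IsContMDiffRiemannianBundle I ∞ E (fun x : M ↦ TangentSpace I x)]

/-- `D` is a totally geodesic foliation: a smooth distribution that is integrable (`[X, Y] ∈ Γ(D)`
for `X, Y ∈ Γ(D)`) and whose leaves have vanishing second fundamental form (`∇_X Y ∈ Γ(D)` for
`X, Y ∈ Γ(D)`). -/
def IsTotallyGeodesicFoliation (D : Π x : M, Submodule ℝ (TangentSpace I x)) : Prop :=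
  IsSmoothDistribution D ∧
    ∀ (U : Set M) (X Y : Π x : M, TangentSpace I x), IsOpen U → IsSectionOn D U X →
      IsSectionOn D U Y → ∀ x ∈ U, mlieBracket I X Y x ∈ D x ∧ nabla X Y x ∈ D x

/-- `D` is an umbilical distribution: a smooth distribution for which there is a vector field `ξ`
orthogonal to `D` (the mean curvature normal) such that, for all `X ∈ Γ(D)`, the component of
`∇_X X` orthogonal to `D` is `g(X, X) ξ`. -/
def IsUmbilical (D : Π x : M, Submodule ℝ (TangentSpace I x)) : Prop :=
  IsSmoothDistribution D ∧
    ∃ ξ : Π x : M, TangentSpace I x, (∀ x, ξ x ∈ (D x)ᗮ) ∧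
      ∀ (U : Set M) (X : Π x : M, TangentSpace I x), IsOpen U → IsSectionOn D U X →
        ∀ x ∈ U, nabla X X x - ⟪X x, X x⟫_ℝ • ξ x ∈ D x

end Distribution

end GrayManifold
end

set_option linter.unusedSectionVars false

noncomputable section
namespace GrayManifold

/-! ### Germs of smooth functions and vector fields. -/

section Smooth

variable {E : Type*} [NormedAddCommGroup E] [NormedSpace ℝ E] [FiniteDimensional ℝ E]
  {H : Type*} [TopologicalSpace H] {I : ModelWithCorners ℝ E H}
  {M : Type*} [TopologicalSpace M] [ChartedSpace H M] [IsManifold I ∞ M]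

/-! Put `κ = 2τ/(dim M + 2)`. The tensor `S = ρ - κ g` has eigenvalue `p = λ - κ` on `D` and `q = μ
- κ` on `D'`. Evaluate the cubic form `g((∇_u S)u, u)` at `u = a + b` with `a ∈ D`, `b ∈ D'`.
Differentiating the eigenvalue equations along local sections produces the differentials of `p` and
`q`, together with `(p - q)` times the mixed components of `∇`. The component of `∇_A A` in `D'`
vanishes because `D` is totally geodesic, and the component of `∇_B B` in `D` is `g(B, B) ξ` because
`D'` is umbilical. Hence (`isKillingTensor_iff`) `S` is Killing exactly when `dp = 0`, `dq` vanishes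
on `D'`, and `dq(a) = 2(p - q) g(ξ, a)` on `D`.

With `d' = rank D'` and `τ = 2λ + d'μ`, `dp` is a nonzero multiple of `dλ - 2dμ`, so the first
condition says that `λ - 2μ` is constant. Once that holds, `dq = -dμ` and `dτ = (d' + 4) dμ`, so the
second condition says that `∇τ` lies in `D`. The third becomes `dμ(a) = 2(μ - λ) g(ξ, a)`, which is
automatic: it is the contracted second Bianchi identity `dτ = 2 div ρ` evaluated on `D`
(`mvfderiv_right_of_isUmbilical`), where rank 2 makes the `dλ` terms cancel.

Most of the work is therefore local Riemannian geometry: smooth orthonormal frames, tensoriality of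
curvature, its symmetries, and both Bianchi identities. -/

variable (I) in
/-- The function `f` is smooth on a neighbourhood of `x`. -/
def SmoothFunAt (f : M → ℝ) (x : M) : Prop := ∀ᶠ y in 𝓝 x, CMDiffAt ∞ f y

/-- The vector field `X` is smooth on a neighbourhood of `x`. -/
def SmoothAt (X : Π x : M, TangentSpace I x) (x : M) : Prop := ∀ᶠ y in 𝓝 x, CMDiffAt ∞ (T% X) y

namespace SmoothFunAt

variable {f g : M → ℝ} {x : M}

/-- Asking for smoothness on a neighbourhood makes the condition open. `CMDiffAt ∞` at a single
point is not: the neighbourhood on which the function is `C^k` may shrink as `k` grows. -/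
theorem eventually (hf : SmoothFunAt I f x) : ∀ᶠ y in 𝓝 x, SmoothFunAt I f y :=
  eventually_eventually_nhds.2 hf

theorem contMDiffAt (hf : SmoothFunAt I f x) : CMDiffAt ∞ f x := hf.self_of_nhds

theorem mdiff (hf : SmoothFunAt I f x) : MDiffAt f x :=
  hf.contMDiffAt.mdifferentiableAt (by simp)

theorem congr (hf : SmoothFunAt I f x) (h : ∀ᶠ y in 𝓝 x, g y = f y) : SmoothFunAt I g x := by
  filter_upwards [hf, eventually_eventually_nhds.2 h] with y h1 h2
  exact h1.congr_of_eventuallyEq h2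

theorem add (hf : SmoothFunAt I f x) (hg : SmoothFunAt I g x) :
    SmoothFunAt I (fun y ↦ f y + g y) x := by
  filter_upwards [hf, hg] with y h1 h2 using h1.add h2

theorem sub (hf : SmoothFunAt I f x) (hg : SmoothFunAt I g x) :
    SmoothFunAt I (fun y ↦ f y - g y) x := by
  filter_upwards [hf, hg] with y h1 h2 using h1.sub h2

theorem mul (hf : SmoothFunAt I f x) (hg : SmoothFunAt I g x) :
    SmoothFunAt I (fun y ↦ f y * g y) x := by
  filter_upwards [hf, hg] with y h1 h2 using h1.mul h2

theorem const (c : ℝ) : SmoothFunAt I (fun _ : M ↦ c) x :=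
  Filter.Eventually.of_forall fun _ ↦ contMDiffAt_const

theorem comp {φ : ℝ → ℝ} (hf : SmoothFunAt I f x) (hφ : ∀ᶠ y in 𝓝 x, ContDiffAt ℝ ∞ φ (f y)) :
    SmoothFunAt I (fun y ↦ φ (f y)) x := by
  filter_upwards [hf, hφ] with y h1 h2
  exact h2.contMDiffAt.comp y h1

theorem sum {ι : Type*} {s : Finset ι} {f : ι → M → ℝ} (hf : ∀ i ∈ s, SmoothFunAt I (f i) x) :
    SmoothFunAt I (fun y ↦ ∑ i ∈ s, f i y) x := by
  have := (Filter.eventually_all_finset s).2 hf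
  filter_upwards [this] with y hy
  exact contMDiffAt_finsetSum hy

end SmoothFunAt

namespace SmoothAt

variable {X Y : Π x : M, TangentSpace I x} {f : M → ℝ} {x : M}

theorem eventually (hX : SmoothAt X x) : ∀ᶠ y in 𝓝 x, SmoothAt X y :=
  eventually_eventually_nhds.2 hX

theorem contMDiffAt (hX : SmoothAt X x) : CMDiffAt ∞ (T% X) x := hX.self_of_nhds

theorem mdiff (hX : SmoothAt X x) : MDiffAt (T% X) x :=
  hX.contMDiffAt.mdifferentiableAt (by simp)

theorem congr (hX : SmoothAt X x) (h : ∀ᶠ y in 𝓝 x, Y y = X y) : SmoothAt Y x := by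
  filter_upwards [hX, eventually_eventually_nhds.2 h] with y h1 h2
  refine h1.congr_of_eventuallyEq ?_
  filter_upwards [h2] with z hz
  simp [hz]

theorem add (hX : SmoothAt X x) (hY : SmoothAt Y x) : SmoothAt (X + Y) x := by
  filter_upwards [hX, hY] with y h1 h2 using h1.add_section h2

theorem sub (hX : SmoothAt X x) (hY : SmoothAt Y x) : SmoothAt (X - Y) x := by
  filter_upwards [hX, hY] with y h1 h2 using h1.sub_section h2

theorem smul (hf : SmoothFunAt I f x) (hX : SmoothAt X x) : SmoothAt (f • X) x := by
  filter_upwards [hf, hX] with y h1 h2 using h1.smul_section h2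

theorem sum {ι : Type*} {s : Finset ι} {X : ι → Π x : M, TangentSpace I x}
    (hX : ∀ i ∈ s, SmoothAt (X i) x) : SmoothAt (fun y ↦ ∑ i ∈ s, X i y) x := by
  have := (Filter.eventually_all_finset s).2 hX
  filter_upwards [this] with y hy
  exact ContMDiffAt.sum_section hy

theorem of_contMDiffOn {U : Set M} (hU : IsOpen U) (hX : CMDiff[U] ∞ (T% X)) (hx : x ∈ U) :
    SmoothAt X x := by
  filter_upwards [hU.mem_nhds hx] with y hy using hX.contMDiffAt (hU.mem_nhds hy)

theorem mlieBracket (hX : SmoothAt X x) (hY : SmoothAt Y x) :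
    SmoothAt (mlieBracket I X Y) x := by
  filter_upwards [hX, hY] with y h1 h2
  -- The bracket costs one derivative, which is harmless since `∞ + 1 = ∞`.
  have : IsManifold I (((⊤ : ℕ∞) : WithTop ℕ∞) + 1) M := by
    simpa using (inferInstance : IsManifold I ∞ M)
  have : IsManifold I (minSmoothness ℝ 2) M := by
    simpa using (inferInstance : IsManifold I 2 M)
  exact ContMDiffAt.mlieBracket_vectorField (n := ⊤) (m := ⊤) h1 h2 (by simp)

theorem localFrame (b : Basis (Fin (finrank ℝ E)) ℝ E) (i : Fin (finrank ℝ E)) :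
    SmoothAt ((trivializationAt E (TangentSpace I) x).localFrame b i) x :=
  of_contMDiffOn (Trivialization.open_baseSet _)
    (Trivialization.contMDiffOn_localFrame_baseSet ∞ _ b i)
    (FiberBundle.mem_baseSet_trivializationAt' x)

/-- The extension has constant coordinates in the trivialization at `x`, hence is smooth on the
whole base set. -/
theorem extend (v : TangentSpace I x) : SmoothAt (FiberBundle.extend E v) x := by
  let t := trivializationAt E (TangentSpace I) x
  refine of_contMDiffOn t.open_baseSet ?_ (FiberBundle.mem_baseSet_trivializationAt' x)
  rw [t.contMDiffOn_section_baseSet_iff]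
  refine (contMDiffOn_const (c := (t ⟨x, v⟩).2)).congr ?_
  intro y hy
  simp only [FiberBundle.extend, t]
  rw [Trivialization.apply_mk_symm _ hy]

/-- The derivative of a smooth function along a smooth vector field is smooth. -/
theorem mvfderiv (hf : SmoothFunAt I f x) (hX : SmoothAt X x) :
    SmoothFunAt I (fun y ↦ d% f y (X y)) x := by
  obtain ⟨U, hfU, hU, hxU⟩ := eventually_nhds_iff.1 (hf.and hX)
  filter_upwards [hU.mem_nhds hxU] with y hy
  have h1 : CMDiff[U] ∞ f := fun z hz ↦ (hfU z hz).1.contMDiffWithinAt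
  have h2 : CMDiff[U] ∞ (T% X) := fun z hz ↦ (hfU z hz).2.contMDiffWithinAt
  -- `df(X)` is the fibre component of the tangent map of `f` composed with the section `X`.
  have h3 := h1.contMDiffOn_tangentMapWithin (m := ∞) (by simp) hU.uniqueMDiffOn
  have h4 := h3.comp h2 (fun z hz ↦ hz)
  have h5 := ((contMDiff_snd_tangentBundle_modelSpace ℝ 𝓘(ℝ, ℝ)).contMDiffOn
    (s := Set.univ)).comp h4 (fun z hz ↦ trivial)
  refine (h5.contMDiffAt (hU.mem_nhds hy)).congr_of_eventuallyEq ?_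
  filter_upwards [hU.mem_nhds hy] with z hz
  have h6 := mfderivWithin_of_isOpen (I := I) (I' := 𝓘(ℝ, ℝ)) (f := f) hU hz
  exact congrArg (fun L : TangentSpace I z →L[ℝ] TangentSpace 𝓘(ℝ, ℝ) (f z) ↦ L (X z)) h6.symm

end SmoothAt

end Smooth

/-! ### Smooth orthonormal frames and tensoriality. -/

section Frame

variable {E : Type*} [NormedAddCommGroup E] [NormedSpace ℝ E] [FiniteDimensional ℝ E]
  {H : Type*} [TopologicalSpace H] {I : ModelWithCorners ℝ E H}
  {M : Type*} [TopologicalSpace M] [ChartedSpace H M] [IsManifold I ∞ M]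
  [RiemannianBundle (fun x : M ↦ TangentSpace I x)]
  [IsContMDiffRiemannianBundle I ∞ E (fun x : M ↦ TangentSpace I x)]

theorem SmoothFunAt.inv {f : M → ℝ} {x : M} (hf : SmoothFunAt I f x)
    (h : ∀ᶠ y in 𝓝 x, f y ≠ 0) : SmoothFunAt I (fun y ↦ (f y)⁻¹) x :=
  hf.comp (h.mono fun _ hy ↦ contDiffAt_inv ℝ hy)

theorem SmoothAt.inner {x : M} {X Y : Π x : M, TangentSpace I x} (hX : SmoothAt X x)
    (hY : SmoothAt Y x) : SmoothFunAt I (fun y ↦ ⟪X y, Y y⟫_ℝ) x := by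
  filter_upwards [hX, hY] with y h1 h2
  exact ContMDiffAt.inner_bundle (E := fun y : M ↦ TangentSpace I y) h1 h2

/-- Linearly independent smooth vector fields can be orthonormalized smoothly. -/
theorem exists_orthonormal_span_eq {x : M} {k : ℕ} {X : Fin k → Π x : M, TangentSpace I x}
    (hX : ∀ i, SmoothAt (X i) x) (hli : ∀ᶠ y in 𝓝 x, LinearIndependent ℝ (fun i ↦ X i y)) :
    ∃ e : Fin k → Π x : M, TangentSpace I x, (∀ i, SmoothAt (e i) x) ∧
      ∀ᶠ y in 𝓝 x, Orthonormal ℝ (fun i ↦ e i y) ∧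
        Submodule.span ℝ (Set.range fun i ↦ e i y) = Submodule.span ℝ (Set.range fun i ↦ X i y) := by
  let G : Fin k → Π y : M, TangentSpace I y :=
    fun i y ↦ InnerProductSpace.gramSchmidt ℝ (fun j ↦ X j y) i
  have hG0 (i) : ∀ᶠ y in 𝓝 x, G i y ≠ 0 :=
    hli.mono fun y hy ↦ InnerProductSpace.gramSchmidt_ne_zero i hy
  have hpos (i) : ∀ᶠ y in 𝓝 x, ⟪G i y, G i y⟫_ℝ ≠ 0 :=
    (hG0 i).mono fun y hy ↦ inner_self_ne_zero.2 hy
  have hG (i) : SmoothAt (G i) x := by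
    -- Each Gram–Schmidt vector involves only earlier ones, with coefficients whose denominators `⟪G
    -- j, G j⟫` do not vanish near `x`.
    induction i using WellFoundedLT.induction with
    | ind i ih =>
    have h1 : SmoothAt (X i - fun y ↦ ∑ j ∈ Finset.Iio i,
        ((fun y ↦ ⟪G j y, X i y⟫_ℝ * (⟪G j y, G j y⟫_ℝ)⁻¹) • G j) y) x := by
      refine (hX i).sub (SmoothAt.sum fun j hj ↦ ?_)
      have hj' := ih j (Finset.mem_Iio.1 hj)
      exact SmoothAt.smul ((hj'.inner (hX i)).mul ((hj'.inner hj').inv (hpos j))) hj'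
    refine h1.congr (Filter.Eventually.of_forall fun y ↦ ?_)
    have := InnerProductSpace.gramSchmidt_def'' ℝ (fun j ↦ X j y) i
    simp only [Pi.sub_apply, Pi.smul_apply']
    rw [eq_sub_iff_add_eq]
    refine Eq.trans ?_ this.symm
    simp [G, div_eq_mul_inv]
  refine ⟨fun i y ↦ InnerProductSpace.gramSchmidtNormed ℝ (fun j ↦ X j y) i, fun i ↦ ?_, ?_⟩
  · have h2 : SmoothFunAt I (fun y ↦ (√⟪G i y, G i y⟫_ℝ)⁻¹) x := by
      refine SmoothFunAt.inv (((hG i).inner (hG i)).comp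
        ((hpos i).mono fun y hy ↦ Real.contDiffAt_sqrt hy)) ((hG0 i).mono fun y hy ↦ ?_)
      rw [← norm_eq_sqrt_real_inner]
      simpa using hy
    refine (SmoothAt.smul h2 (hG i)).congr (Filter.Eventually.of_forall fun y ↦ ?_)
    simp only [Pi.smul_apply', InnerProductSpace.gramSchmidtNormed]
    rw [← norm_eq_sqrt_real_inner]
    rfl
  · filter_upwards [hli] with y hy
    refine ⟨InnerProductSpace.gramSchmidtNormed_orthonormal hy, ?_⟩
    rw [InnerProductSpace.span_gramSchmidtNormed_range, InnerProductSpace.span_gramSchmidt]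

/-- The vector fields `e i` are smooth near `x` and form orthonormal bases there. -/
structure IsOrthonormalFrameAt {ι : Type*} [Fintype ι] (e : ι → Π x : M, TangentSpace I x)
    (x : M) : Prop where
  smoothAt : ∀ i, SmoothAt (e i) x
  basis : ∀ᶠ y in 𝓝 x, ∃ b : OrthonormalBasis ι ℝ (TangentSpace I y), ∀ i, b i = e i y

theorem exists_isOrthonormalFrameAt (x : M) :
    ∃ e : Fin (finrank ℝ E) → Π x : M, TangentSpace I x, IsOrthonormalFrameAt e x := by
  let t := trivializationAt E (TangentSpace I) x
  have hx : x ∈ t.baseSet := FiberBundle.mem_baseSet_trivializationAt' x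
  let b := finBasis ℝ E
  have hfr := t.isLocalFrameOn_localFrame_baseSet I ∞ b
  obtain ⟨e, h1, h2⟩ := exists_orthonormal_span_eq (X := t.localFrame b)
    (fun i ↦ SmoothAt.localFrame b i)
    (Filter.eventually_of_mem (t.open_baseSet.mem_nhds hx) fun y hy ↦ hfr.linearIndependent hy)
  refine ⟨e, h1, ?_⟩
  filter_upwards [h2, t.open_baseSet.mem_nhds hx] with y hy hyt
  have hs : ⊤ ≤ Submodule.span ℝ (Set.range fun i ↦ e i y) := hy.2 ▸ hfr.generating hyt
  exact ⟨OrthonormalBasis.mk hy.1 hs, fun i ↦ by simp⟩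

namespace IsOrthonormalFrameAt

variable {ι : Type*} [Fintype ι] {e : ι → Π x : M, TangentSpace I x} {x : M}

theorem eventually (he : IsOrthonormalFrameAt e x) : ∀ᶠ y in 𝓝 x, IsOrthonormalFrameAt e y := by
  filter_upwards [Filter.eventually_all.2 fun i ↦ (he.smoothAt i).eventually,
    eventually_eventually_nhds.2 he.basis] with y h1 h2 using ⟨h1, h2⟩

theorem exists_basis (he : IsOrthonormalFrameAt e x) :
    ∃ b : OrthonormalBasis ι ℝ (TangentSpace I x), ∀ i, b i = e i x := he.basis.self_of_nhds

theorem sum_inner_smul (he : IsOrthonormalFrameAt e x) (v : TangentSpace I x) :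
    ∑ i, ⟪e i x, v⟫_ℝ • e i x = v := by
  obtain ⟨b, hb⟩ := he.exists_basis
  simpa [hb] using b.sum_repr' v

theorem inner_eq [DecidableEq ι] (he : IsOrthonormalFrameAt e x) (i j : ι) :
    ⟪e i x, e j x⟫_ℝ = if i = j then 1 else 0 := by
  obtain ⟨b, hb⟩ := he.exists_basis
  rw [← hb, ← hb]
  exact orthonormal_iff_ite.1 b.orthonormal i j

theorem smoothAt_of_inner (he : IsOrthonormalFrameAt e x) {X : Π x : M, TangentSpace I x}
    (h : ∀ i, SmoothFunAt I (fun y ↦ ⟪e i y, X y⟫_ℝ) x) : SmoothAt X x := by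
  have h1 : SmoothAt (fun y ↦ ∑ i, ((fun y ↦ ⟪e i y, X y⟫_ℝ) • e i) y) x :=
    SmoothAt.sum fun i _ ↦ SmoothAt.smul (h i) (he.smoothAt i)
  refine h1.congr (he.eventually.mono fun y hy ↦ ?_)
  exact (hy.sum_inner_smul (X y)).symm

end IsOrthonormalFrameAt

/-- Serves fields known only through their inner products: `∇_X Y` via the Koszul formula, and the
Ricci endomorphism. -/
theorem smoothAt_of_forall_inner {x : M} {X : Π x : M, TangentSpace I x}
    (h : ∀ Z : Π x : M, TangentSpace I x, SmoothAt Z x → SmoothFunAt I (fun y ↦ ⟪X y, Z y⟫_ℝ) x) :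
    SmoothAt X x := by
  obtain ⟨e, he⟩ := exists_isOrthonormalFrameAt (I := I) x
  refine he.smoothAt_of_inner fun i ↦ ?_
  simpa only [real_inner_comm] using h (e i) (he.smoothAt i)

/-- A map on vector fields which is linear over smooth functions is determined by the value
at `x`. -/
theorem eq_of_smooth_linear {A : Type*} [AddCommGroup A] [Module ℝ A] {x : M}
    {Φ : (Π x : M, TangentSpace I x) → A}
    (hadd : ∀ X Y, SmoothAt X x → SmoothAt Y x → Φ (X + Y) = Φ X + Φ Y)
    (hsmul : ∀ f X, SmoothFunAt I f x → SmoothAt X x → Φ (f • X) = f x • Φ X)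
    {X X' : Π x : M, TangentSpace I x} (hX : SmoothAt X x) (hX' : SmoothAt X' x)
    (h : X x = X' x) : Φ X = Φ X' := by
  classical
  have hloc : ∀ X Y, SmoothAt X x → SmoothAt Y x → (∀ᶠ y in 𝓝 x, X y = Y y) → Φ X = Φ Y := by
    intro X Y hX hY hXY
    -- No bump function is needed: smoothness is required only near `x`, where this indicator
    -- function is identically `1`.
    let ψ : M → ℝ := fun y ↦ if X y = Y y then 1 else 0
    have hψ : SmoothFunAt I ψ x :=
      (SmoothFunAt.const 1).congr (hXY.mono fun y hy ↦ by simp [ψ, hy])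
    have hψx : ψ x = 1 := by simp [ψ, hXY.self_of_nhds]
    have hψX : ψ • X = ψ • Y := by
      funext y
      by_cases hy : X y = Y y <;> simp [ψ, hy]
    calc Φ X = Φ (ψ • X) := by rw [hsmul _ _ hψ hX, hψx, one_smul]
      _ = Φ Y := by rw [hψX, hsmul _ _ hψ hY, hψx, one_smul]
  have hzero : Φ 0 = 0 := by
    have h0 : SmoothAt (0 : Π x : M, TangentSpace I x) x := by
      simpa using hX.sub hX
    have := hadd 0 0 h0 h0
    simpa using this
  have hsum : ∀ {ι : Type} (s : Finset ι) (V : ι → Π x : M, TangentSpace I x),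
      (∀ i, SmoothAt (V i) x) → Φ (fun y ↦ ∑ i ∈ s, V i y) = ∑ i ∈ s, Φ (V i) := by
    intro ι s V hV
    induction s using Finset.induction_on with
    | empty => simpa using! hzero
    | insert a s ha ih =>
      simp only [Finset.sum_insert ha]
      rw [← ih]
      exact hadd _ _ (hV a) (SmoothAt.sum fun i _ ↦ hV i)
  obtain ⟨e, he⟩ := exists_isOrthonormalFrameAt (I := I) x
  -- Expanding `X` in a local frame shows that `Φ X` depends only on the coefficients at `x`.
  have key : ∀ X, SmoothAt X x → Φ X = ∑ i, ⟪e i x, X x⟫_ℝ • Φ (e i) := by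
    intro X hX
    have hc (i) := (he.smoothAt i).inner hX
    rw [hloc X (fun y ↦ ∑ i, ((fun y ↦ ⟪e i y, X y⟫_ℝ) • e i) y) hX
      (SmoothAt.sum fun i _ ↦ SmoothAt.smul (hc i) (he.smoothAt i))
      (he.eventually.mono fun y hy ↦ (hy.sum_inner_smul (X y)).symm),
      hsum _ _ fun i ↦ SmoothAt.smul (hc i) (he.smoothAt i)]
    exact Finset.sum_congr rfl fun i _ ↦ hsmul _ _ (hc i) (he.smoothAt i)
  rw [key X hX, key X' hX', h]

end Frame

/-! ### Calculus of the Levi-Civita connection and of the curvature operator. -/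

section Connection

variable {E : Type*} [NormedAddCommGroup E] [NormedSpace ℝ E] [FiniteDimensional ℝ E]
  {H : Type*} [TopologicalSpace H] {I : ModelWithCorners ℝ E H}
  {M : Type*} [TopologicalSpace M] [ChartedSpace H M] [IsManifold I ∞ M]
  [RiemannianBundle (fun x : M ↦ TangentSpace I x)]
  [IsContMDiffRiemannianBundle I ∞ E (fun x : M ↦ TangentSpace I x)]

variable {x : M} {X X' Y Y' Z W : Π x : M, TangentSpace I x} {f : M → ℝ}

theorem mvfderiv_congr {f g : M → ℝ} (h : f =ᶠ[𝓝 x] g) : d% f x = d% g x := by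
  ext v
  exact congrArg (fun L : TangentSpace I x →L[ℝ] ℝ ↦ L v) (h.mfderiv_eq (I := I) (I' := 𝓘(ℝ, ℝ)))

theorem nabla_apply : nabla X Y x = leviCivita Y x (X x) := rfl

theorem nabla_add_left : nabla (X + X') Y = nabla X Y + nabla X' Y := by
  funext x; simp [nabla]

theorem nabla_neg_left : nabla (-X) Y = -nabla X Y := by
  funext x; simp [nabla]

theorem nabla_smul_left : nabla (f • X) Y = f • nabla X Y := by
  funext x; simp [nabla]

theorem nabla_add_right (hY : SmoothAt Y x) (hY' : SmoothAt Y' x) :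
    nabla X (Y + Y') x = nabla X Y x + nabla X Y' x := by
  simp [nabla, leviCivita.isCovariantDerivativeOnUniv.add hY.mdiff hY'.mdiff]

theorem nabla_smul_right (hf : SmoothFunAt I f x) (hY : SmoothAt Y x) :
    nabla X (f • Y) x = f x • nabla X Y x + d% f x (X x) • Y x := by
  simp [nabla, leviCivita.isCovariantDerivativeOnUniv.leibniz hY.mdiff hf.mdiff]

theorem nabla_congr (hY : SmoothAt Y x) (hY' : SmoothAt Y' x) (h : ∀ᶠ y in 𝓝 x, Y y = Y' y) :
    nabla X Y x = nabla X Y' x := by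
  have := leviCivita.isCovariantDerivativeOnUniv.congr_of_eventuallyEq hY.mdiff hY'.mdiff
    Filter.univ_mem h
  simp only [nabla]
  rw [this]

theorem nabla_neg_right (hY : SmoothAt Y x) : nabla X (-Y) x = -nabla X Y x := by
  have := leviCivita.isCovariantDerivativeOnUniv.smul_const (-1 : ℝ) hY.mdiff
  rw [neg_one_smul, neg_one_smul] at this
  exact congrArg (fun L : TangentSpace I x →L[ℝ] TangentSpace I x ↦ L (X x)) this

theorem nabla_sub_right (hY : SmoothAt Y x) (hY' : SmoothAt Y' x) :
    nabla X (Y - Y') x = nabla X Y x - nabla X Y' x := by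
  have := nabla_add_right (X := X) (hY.sub hY') hY'
  rw [sub_add_cancel] at this
  rw [this, add_sub_cancel_right]

theorem nabla_sub_nabla (hX : SmoothAt X x) (hY : SmoothAt Y x) :
    nabla X Y x - nabla Y X x = mlieBracket I X Y x :=
  (CovariantDerivative.torsion_eq_zero_iff _).1 leviCivita_torsion hX.mdiff hY.mdiff

theorem mvfderiv_inner (hX : SmoothAt X x) (hY : SmoothAt Y x) (hZ : SmoothAt Z x) :
    d% (fun y ↦ ⟪Y y, Z y⟫_ℝ) x (X x) = ⟪nabla X Y x, Z x⟫_ℝ + ⟪Y x, nabla X Z x⟫_ℝ :=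
  leviCivita_metric hX.mdiff hY.mdiff hZ.mdiff

theorem SmoothAt.nabla (hX : SmoothAt X x) (hY : SmoothAt Y x) : SmoothAt (nabla X Y) x := by
  refine smoothAt_of_forall_inner fun Z hZ ↦ ?_
  have h : SmoothFunAt I (koszulForm Y X Z) x := by
    refine (SmoothFunAt.const (1 / 2)).mul ?_
    exact (((((SmoothAt.mvfderiv (hY.inner hZ) hX).add (SmoothAt.mvfderiv (hZ.inner hX) hY)).sub
      (SmoothAt.mvfderiv (hX.inner hY) hZ)).add ((hX.mlieBracket hY).inner hZ)).sub
      ((hX.mlieBracket hZ).inner hY)).sub ((hY.mlieBracket hZ).inner hX)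
  refine h.congr ?_
  filter_upwards [hX.eventually, hY.eventually, hZ.eventually] with y h1 h2 h3
  exact inner_leviCivitaFun h1.mdiff h2.mdiff h3.mdiff

theorem leibniz_mlieBracket (hX : SmoothAt X x) (hY : SmoothAt Y x) (hZ : SmoothAt Z x) :
    mlieBracket I X (mlieBracket I Y Z) x =
      mlieBracket I (mlieBracket I X Y) Z x + mlieBracket I Y (mlieBracket I X Z) x := by
  have : IsManifold I (minSmoothness ℝ 3) M := by
    simpa using (inferInstance : IsManifold I 3 M)
  have h2 : minSmoothness ℝ 2 ≤ ∞ := by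
    simpa using ENat.LEInfty.out (m := 2)
  exact leibniz_identity_mlieBracket_apply (hX.contMDiffAt.of_le h2) (hY.contMDiffAt.of_le h2)
    (hZ.contMDiffAt.of_le h2)

/-- The Lie bracket acts on functions as the commutator of derivations. -/
theorem mvfderiv_mlieBracket (hf : SmoothFunAt I f x) (hX : SmoothAt X x) (hY : SmoothAt Y x) :
    d% f x (mlieBracket I X Y x) =
      d% (fun y ↦ d% f y (Y y)) x (X x) - d% (fun y ↦ d% f y (X y)) x (Y x) := by
  -- The identity will be read off as a coefficient of a field `Z`, so `Z x` must be nonzero; a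
  -- trivial tangent space is treated apart.
  by_cases hv : ∃ v : TangentSpace I x, v ≠ 0
  swap
  · push Not at hv
    rw [hv (mlieBracket I X Y x), hv (X x), hv (Y x)]
    simp
  obtain ⟨v, hv⟩ := hv
  set Z : Π x : M, TangentSpace I x := FiberBundle.extend E v with hZdef
  have hZ : SmoothAt Z x := SmoothAt.extend v
  have hZx : Z x = v := by simp [Z]
  have key : ∀ {X Y : Π x : M, TangentSpace I x}, SmoothAt X x → SmoothAt Y x →
      mlieBracket I X (mlieBracket I Y (f • Z)) x =
        d% (fun y ↦ d% f y (Y y)) x (X x) • Z x + d% f x (Y x) • mlieBracket I X Z x +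
          (d% f x (X x) • mlieBracket I Y Z x + f x • mlieBracket I X (mlieBracket I Y Z) x) := by
    intro X Y hX hY
    have h1 : mlieBracket I Y (f • Z) =ᶠ[𝓝 x]
        (fun y ↦ d% f y (Y y)) • Z + f • mlieBracket I Y Z := by
      filter_upwards [hf.eventually, hZ.eventually] with y h1 h2
      exact mlieBracket_smul_right h1.mdiff h2.mdiff
    have h2 := SmoothAt.mvfderiv hf hY
    rw [Filter.EventuallyEq.mlieBracket_vectorField_eq (Filter.EventuallyEq.refl _ X) h1,
      mlieBracket_add_right (SmoothAt.smul h2 hZ).mdiff (SmoothAt.smul hf (hY.mlieBracket hZ)).mdiff,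
      mlieBracket_smul_right h2.mdiff hZ.mdiff,
      mlieBracket_smul_right hf.mdiff (hY.mlieBracket hZ).mdiff]
  -- Expanding the Jacobi identity for `X`, `Y`, `f Z` and subtracting `f` times that for `X`, `Y`,
  -- `Z` leaves only a multiple of `Z`.
  have hJ := leibniz_mlieBracket hX hY (SmoothAt.smul hf hZ)
  rw [key hX hY, key hY hX, mlieBracket_smul_right hf.mdiff hZ.mdiff,
    leibniz_mlieBracket hX hY hZ] at hJ
  have h0 : (d% f x (mlieBracket I X Y x) -
      (d% (fun y ↦ d% f y (Y y)) x (X x) - d% (fun y ↦ d% f y (X y)) x (Y x))) • v = 0 := by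
    rw [← hZx]
    linear_combination (norm := module) -hJ
  exact sub_eq_zero.1 ((smul_eq_zero.1 h0).resolve_right hv)

theorem SmoothAt.curvatureOp (hX : SmoothAt X x) (hY : SmoothAt Y x) (hZ : SmoothAt Z x) :
    SmoothAt (curvatureOp X Y Z) x :=
  ((hX.nabla (hY.nabla hZ)).sub (hY.nabla (hX.nabla hZ))).sub ((hX.mlieBracket hY).nabla hZ)

theorem curvatureOp_swap : curvatureOp X Y Z = -curvatureOp Y X Z := by
  rw [curvatureOp, curvatureOp, mlieBracket_swap (V := Y), nabla_neg_left]
  abel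

theorem curvatureOp_apply : curvatureOp X Y Z x =
    nabla X (nabla Y Z) x - nabla Y (nabla X Z) x - nabla (mlieBracket I X Y) Z x := rfl

theorem curvatureOp_add_left (hX : SmoothAt X x) (hX' : SmoothAt X' x) (hZ : SmoothAt Z x) :
    curvatureOp (X + X') Y Z x = curvatureOp X Y Z x + curvatureOp X' Y Z x := by
  simp only [curvatureOp_apply, nabla_add_left, Pi.add_apply,
    nabla_add_right (X := Y) (hX.nabla hZ) (hX'.nabla hZ)]
  have h : nabla (mlieBracket I (X + X') Y) Z x =
      nabla (mlieBracket I X Y) Z x + nabla (mlieBracket I X' Y) Z x := by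
    simp [nabla, mlieBracket_add_left hX.mdiff hX'.mdiff]
  rw [h]
  abel

theorem curvatureOp_smul_left (hf : SmoothFunAt I f x) (hX : SmoothAt X x)
    (hZ : SmoothAt Z x) : curvatureOp (f • X) Y Z x = f x • curvatureOp X Y Z x := by
  simp only [curvatureOp_apply, nabla_smul_left, Pi.smul_apply',
    nabla_smul_right (X := Y) hf (hX.nabla hZ)]
  have h : nabla (mlieBracket I (f • X) Y) Z x =
      f x • nabla (mlieBracket I X Y) Z x - d% f x (Y x) • nabla X Z x := by
    simp [nabla, mlieBracket_smul_left hf.mdiff hX.mdiff]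
    abel
  rw [h]
  module

theorem curvatureOp_add_right (hX : SmoothAt X x) (hY : SmoothAt Y x) (hZ : SmoothAt Z x)
    (hW : SmoothAt W x) :
    curvatureOp X Y (Z + W) x = curvatureOp X Y Z x + curvatureOp X Y W x := by
  have key : ∀ {X Y : Π x : M, TangentSpace I x}, SmoothAt X x → SmoothAt Y x →
      nabla X (nabla Y (Z + W)) x = nabla X (nabla Y Z) x + nabla X (nabla Y W) x := by
    intro X Y hX hY
    rw [← nabla_add_right (hY.nabla hZ) (hY.nabla hW)]
    refine nabla_congr (hY.nabla (hZ.add hW)) ((hY.nabla hZ).add (hY.nabla hW)) ?_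
    filter_upwards [hZ.eventually, hW.eventually] with y h1 h2 using nabla_add_right h1 h2
  rw [curvatureOp_apply, key hX hY, key hY hX, nabla_add_right hZ hW, curvatureOp_apply,
    curvatureOp_apply]
  abel

/-- The first-derivative terms are symmetric in `X`, `Y` and cancel; the second derivatives of `f`
form the commutator `[X, Y] f`, cancelled by the bracket term. -/
theorem curvatureOp_smul_right (hf : SmoothFunAt I f x) (hX : SmoothAt X x) (hY : SmoothAt Y x)
    (hZ : SmoothAt Z x) : curvatureOp X Y (f • Z) x = f x • curvatureOp X Y Z x := by
  have key : ∀ {X Y : Π x : M, TangentSpace I x}, SmoothAt X x → SmoothAt Y x →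
      nabla X (nabla Y (f • Z)) x = f x • nabla X (nabla Y Z) x + d% f x (X x) • nabla Y Z x +
        (d% f x (Y x) • nabla X Z x + d% (fun y ↦ d% f y (Y y)) x (X x) • Z x) := by
    intro X Y hX hY
    have h2 := SmoothAt.mvfderiv hf hY
    rw [← nabla_smul_right hf (hY.nabla hZ), ← nabla_smul_right h2 hZ,
      ← nabla_add_right (SmoothAt.smul hf (hY.nabla hZ)) (SmoothAt.smul h2 hZ)]
    refine nabla_congr (hY.nabla (SmoothAt.smul hf hZ))
      ((SmoothAt.smul hf (hY.nabla hZ)).add (SmoothAt.smul h2 hZ)) ?_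
    filter_upwards [hf.eventually, hZ.eventually] with y h1 h2 using nabla_smul_right h1 h2
  rw [curvatureOp_apply, key hX hY, key hY hX, nabla_smul_right hf hZ, curvatureOp_apply,
    mvfderiv_mlieBracket hf hX hY]
  module

/-- The curvature operator is tensorial on smooth vector fields. -/
theorem curvature_eq_curvatureOp (hX : SmoothAt X x) (hY : SmoothAt Y x) (hZ : SmoothAt Z x) :
    curvature x (X x) (Y x) (Z x) = curvatureOp X Y Z x := by
  have hX0 := SmoothAt.extend (X x)
  have hY0 := SmoothAt.extend (Y x)
  have hZ0 := SmoothAt.extend (Z x)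
  rw [curvature]
  trans curvatureOp X (FiberBundle.extend E (Y x)) (FiberBundle.extend E (Z x)) x
  · exact eq_of_smooth_linear
      (Φ := fun X ↦ curvatureOp X (FiberBundle.extend E (Y x)) (FiberBundle.extend E (Z x)) x)
      (fun _ _ h1 h2 ↦ curvatureOp_add_left h1 h2 hZ0)
      (fun _ _ h1 h2 ↦ curvatureOp_smul_left h1 h2 hZ0) hX0 hX (by simp)
  trans curvatureOp X Y (FiberBundle.extend E (Z x)) x
  · rw [curvatureOp_swap, curvatureOp_swap (X := X), Pi.neg_apply, Pi.neg_apply]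
    congr 1
    exact eq_of_smooth_linear (Φ := fun Y ↦ curvatureOp Y X (FiberBundle.extend E (Z x)) x)
      (fun _ _ h1 h2 ↦ curvatureOp_add_left h1 h2 hZ0)
      (fun _ _ h1 h2 ↦ curvatureOp_smul_left h1 h2 hZ0) hY0 hY (by simp)
  · exact eq_of_smooth_linear (Φ := fun Z ↦ curvatureOp X Y Z x)
      (fun _ _ h1 h2 ↦ curvatureOp_add_right hX hY h1 h2)
      (fun _ _ h1 h2 ↦ curvatureOp_smul_right h1 hX hY h2) hZ0 hZ (by simp)

/-- The curvature operator is skew-adjoint. -/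
theorem inner_curvatureOp_self (hX : SmoothAt X x) (hY : SmoothAt Y x) (hZ : SmoothAt Z x) :
    ⟪curvatureOp X Y Z x, Z x⟫_ℝ = 0 := by
  have hf : SmoothFunAt I (fun y ↦ ⟪Z y, Z y⟫_ℝ) x := hZ.inner hZ
  -- Second derivatives of `|Z|²`: the term `⟪∇_Y Z, ∇_X Z⟫` is symmetric, so the commutator leaves
  -- only curvature.
  have key : ∀ {X Y : Π x : M, TangentSpace I x}, SmoothAt X x → SmoothAt Y x →
      d% (fun y ↦ d% (fun z ↦ ⟪Z z, Z z⟫_ℝ) y (Y y)) x (X x) =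
        2 * ⟪nabla X (nabla Y Z) x, Z x⟫_ℝ + 2 * ⟪nabla Y Z x, nabla X Z x⟫_ℝ := by
    intro X Y hX hY
    have h1 : (fun y ↦ d% (fun z ↦ ⟪Z z, Z z⟫_ℝ) y (Y y)) =ᶠ[𝓝 x]
        fun y ↦ 2 * ⟪nabla Y Z y, Z y⟫_ℝ := by
      filter_upwards [hY.eventually, hZ.eventually] with y h1 h2
      rw [mvfderiv_inner h1 h2 h2, real_inner_comm (Z y)]
      ring
    rw [mvfderiv_congr h1, mvfderiv_fun_mul (SmoothFunAt.const (I := I) 2).mdiff ((hY.nabla hZ).inner hZ).mdiff]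
    simp [mvfderiv_const, mvfderiv_inner hX (hY.nabla hZ) hZ]
    ring
  have h3 := mvfderiv_mlieBracket hf hX hY
  rw [key hX hY, key hY hX, mvfderiv_inner (hX.mlieBracket hY) hZ hZ] at h3
  rw [curvatureOp_apply, inner_sub_left, inner_sub_left]
  rw [real_inner_comm (nabla Y Z x) (nabla X Z x),
    real_inner_comm (nabla (mlieBracket I X Y) Z x) (Z x)] at h3
  linarith

/-- The first Bianchi identity. -/
theorem curvatureOp_cyclic (hX : SmoothAt X x) (hY : SmoothAt Y x) (hZ : SmoothAt Z x) :
    curvatureOp X Y Z x + curvatureOp Y Z X x + curvatureOp Z X Y x = 0 := by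
  -- Torsion-freeness, used twice, reduces the cyclic sum to the Jacobi identity.
  have key : ∀ {X Y Z : Π x : M, TangentSpace I x}, SmoothAt X x → SmoothAt Y x → SmoothAt Z x →
      nabla X (nabla Y Z) x - nabla X (nabla Z Y) x = nabla (mlieBracket I Y Z) X x +
        mlieBracket I X (mlieBracket I Y Z) x := by
    intro X Y Z hX hY hZ
    rw [← nabla_sub_right (hY.nabla hZ) (hZ.nabla hY), ← nabla_sub_nabla hX (hY.mlieBracket hZ),
      add_sub_cancel]
    refine nabla_congr ((hY.nabla hZ).sub (hZ.nabla hY)) (hY.mlieBracket hZ) ?_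
    filter_upwards [hY.eventually, hZ.eventually] with y h1 h2 using nabla_sub_nabla h1 h2
  have h1 := key hX hY hZ
  have h2 := key hY hZ hX
  have h3 := key hZ hX hY
  have hJ := leibniz_mlieBracket hX hY hZ
  have h4 : mlieBracket I (mlieBracket I X Y) Z x = -mlieBracket I Z (mlieBracket I X Y) x :=
    mlieBracket_swap_apply
  have h5 : mlieBracket I Y (mlieBracket I X Z) x = -mlieBracket I Y (mlieBracket I Z X) x := by
    have h6 := nabla_sub_nabla hY (hX.mlieBracket hZ)
    have h7 := nabla_sub_nabla hY (hZ.mlieBracket hX)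
    rw [← h6, ← h7, mlieBracket_swap (V := X) (W := Z)]
    rw [nabla_neg_left, nabla_neg_right (hZ.mlieBracket hX), Pi.neg_apply]
    abel
  rw [h4, h5] at hJ
  simp only [curvatureOp_apply]
  linear_combination (norm := module) h1 + h2 + h3 + hJ

end Connection

/-! ### Symmetries of the curvature tensor; Ricci and scalar curvature. -/

section Curvature

variable {E : Type*} [NormedAddCommGroup E] [NormedSpace ℝ E] [FiniteDimensional ℝ E]
  {H : Type*} [TopologicalSpace H] {I : ModelWithCorners ℝ E H}
  {M : Type*} [TopologicalSpace M] [ChartedSpace H M] [IsManifold I ∞ M]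
  [RiemannianBundle (fun x : M ↦ TangentSpace I x)]
  [IsContMDiffRiemannianBundle I ∞ E (fun x : M ↦ TangentSpace I x)]

variable {x : M}

theorem curvature_add_left (u u' v w : TangentSpace I x) :
    curvature x (u + u') v w = curvature x u v w + curvature x u' v w := by
  have h := curvatureOp_add_left (Y := FiberBundle.extend E v) (SmoothAt.extend u)
    (SmoothAt.extend u') (SmoothAt.extend w)
  rw [← curvature_eq_curvatureOp ((SmoothAt.extend u).add (SmoothAt.extend u'))
    (SmoothAt.extend v) (SmoothAt.extend w)] at h
  simpa [curvature] using h

theorem curvature_smul_left (c : ℝ) (u v w : TangentSpace I x) :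
    curvature x (c • u) v w = c • curvature x u v w := by
  have h := curvatureOp_smul_left (Y := FiberBundle.extend E v) (SmoothFunAt.const c)
    (SmoothAt.extend u) (SmoothAt.extend w)
  rw [← curvature_eq_curvatureOp (SmoothAt.smul (SmoothFunAt.const c) (SmoothAt.extend u))
    (SmoothAt.extend v) (SmoothAt.extend w)] at h
  simpa [curvature] using h

theorem curvature_add_right (u v w w' : TangentSpace I x) :
    curvature x u v (w + w') = curvature x u v w + curvature x u v w' := by
  have h := curvatureOp_add_right (SmoothAt.extend u) (SmoothAt.extend v) (SmoothAt.extend w)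
    (SmoothAt.extend w')
  rw [← curvature_eq_curvatureOp (SmoothAt.extend u) (SmoothAt.extend v)
    ((SmoothAt.extend w).add (SmoothAt.extend w'))] at h
  simpa [curvature] using h

theorem curvature_smul_right (c : ℝ) (u v w : TangentSpace I x) :
    curvature x u v (c • w) = c • curvature x u v w := by
  have h := curvatureOp_smul_right (SmoothFunAt.const c) (SmoothAt.extend u) (SmoothAt.extend v)
    (SmoothAt.extend w)
  rw [← curvature_eq_curvatureOp (SmoothAt.extend u) (SmoothAt.extend v)
    (SmoothAt.smul (SmoothFunAt.const c) (SmoothAt.extend w))] at h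
  simpa [curvature] using h

theorem curvature_swap (u v w : TangentSpace I x) : curvature x u v w = -curvature x v u w := by
  rw [curvature, curvatureOp_swap]
  rfl

/-- The curvature tensor at `x` as a trilinear map. -/
def curvatureLin (x : M) : TangentSpace I x →ₗ[ℝ] TangentSpace I x →ₗ[ℝ]
    TangentSpace I x →ₗ[ℝ] TangentSpace I x :=
  LinearMap.mk₂ ℝ (fun u v ↦
    { toFun := fun w ↦ curvature x u v w
      map_add' := curvature_add_right u v
      map_smul' := fun c w ↦ curvature_smul_right c u v w })
    (fun u u' v ↦ LinearMap.ext fun w ↦ curvature_add_left u u' v w)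
    (fun c u v ↦ LinearMap.ext fun w ↦ curvature_smul_left c u v w)
    (fun u v v' ↦ LinearMap.ext fun w ↦ by
      simp only [LinearMap.coe_mk, AddHom.coe_mk, LinearMap.add_apply]
      rw [curvature_swap, curvature_add_left, neg_add, ← curvature_swap, ← curvature_swap])
    (fun c u v ↦ LinearMap.ext fun w ↦ by
      simp only [LinearMap.coe_mk, AddHom.coe_mk, LinearMap.smul_apply]
      rw [curvature_swap, curvature_smul_left, ← smul_neg, ← curvature_swap])

theorem curvatureLin_apply (u v w : TangentSpace I x) :
    curvatureLin x u v w = curvature x u v w := rfl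

/-- The covariant curvature tensor `g(R(u, v) w, z)`. -/
def riem (x : M) (u v w z : TangentSpace I x) : ℝ := ⟪curvature x u v w, z⟫_ℝ

theorem riem_swap_left (u v w z : TangentSpace I x) : riem x u v w z = -riem x v u w z := by
  rw [riem, curvature_swap, inner_neg_left, riem]

theorem riem_self_right (u v w : TangentSpace I x) : riem x u v w w = 0 := by
  have := inner_curvatureOp_self (SmoothAt.extend u) (SmoothAt.extend v) (SmoothAt.extend w)
  simpa [riem, curvature] using this

theorem riem_swap_right (u v w z : TangentSpace I x) : riem x u v w z = -riem x u v z w := by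
  have h := riem_self_right u v (w + z)
  have h1 := riem_self_right u v w
  have h2 := riem_self_right u v z
  simp only [riem, curvature_add_right, inner_add_left, inner_add_right] at h h1 h2 ⊢
  linarith

theorem riem_cyclic (u v w z : TangentSpace I x) :
    riem x u v w z + riem x v w u z + riem x w u v z = 0 := by
  have := curvatureOp_cyclic (SmoothAt.extend u) (SmoothAt.extend v) (SmoothAt.extend w)
  simp only [riem, ← inner_add_left, curvature]
  rw [this, inner_zero_left]

/-- A linear combination of the first Bianchi identity for the four cyclic rotations of the
arguments, matched up by the two skew symmetries. -/
theorem riem_pair_symm (u v w z : TangentSpace I x) : riem x u v w z = riem x w z u v := by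
  have h1 := riem_cyclic u v w z
  have h2 := riem_cyclic v w z u
  have h3 := riem_cyclic w z u v
  have h4 := riem_cyclic z u v w
  have e1 := riem_swap_right u v w z
  have e2 := riem_swap_right v w u z
  have e3 := riem_swap_right w u v z
  have e4 := riem_swap_right v z w u
  have e5 := riem_swap_right z w u v
  have e6 := riem_swap_right z u v w
  have e7 := riem_swap_left w z u v
  have e8 := riem_swap_left w u v z
  have e9 := riem_swap_left z v w u
  have e10 := riem_swap_left u w z v
  have e11 := riem_swap_left z v u w
  have e12 := riem_swap_left w u z v
  have e13 := riem_swap_right z v u w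
  have e14 := riem_swap_right v w z u
  have e15 := riem_swap_right z w v u
  have e16 := riem_swap_right w u z v
  have e17 := riem_swap_right u v z w
  have e18 := riem_swap_left z w v u
  linarith

/-- The Ricci tensor at `x` as a bilinear form. -/
def ricciLin (x : M) : TangentSpace I x →ₗ[ℝ] TangentSpace I x →ₗ[ℝ] ℝ :=
  LinearMap.mk₂ ℝ (ricci x)
    (fun u u' v ↦ by simp [ricci, ← curvatureLin_apply, inner_add_left, Finset.sum_add_distrib])
    (fun c u v ↦ by simp [ricci, ← curvatureLin_apply, inner_smul_left, Finset.mul_sum])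
    (fun u v v' ↦ by simp [ricci, ← curvatureLin_apply, inner_add_left, Finset.sum_add_distrib])
    (fun c u v ↦ by simp [ricci, ← curvatureLin_apply, inner_smul_left, Finset.mul_sum])

theorem ricciLin_apply (u v : TangentSpace I x) : ricciLin x u v = ricci x u v := rfl

/-- Basis independence of the trace. It allows a smooth moving frame in place of the standard basis,
which is chosen point by point. -/
theorem ricci_eq_sum {ι : Type*} [Fintype ι] (b : OrthonormalBasis ι ℝ (TangentSpace I x))
    (u v : TangentSpace I x) : ricci x u v = ∑ i, riem x (b i) u v (b i) := by
  let A : TangentSpace I x →ₗ[ℝ] TangentSpace I x :=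
    { toFun := fun z ↦ curvature x z u v
      map_add' := fun z z' ↦ curvature_add_left z z' u v
      map_smul' := fun c z ↦ curvature_smul_left c z u v }
  have h1 := A.trace_eq_sum_inner b
  have h2 := A.trace_eq_sum_inner (stdOrthonormalBasis ℝ (TangentSpace I x))
  rw [h1] at h2
  simp only [riem, ricci, real_inner_comm]
  exact h2.symm

theorem ricci_symm (u v : TangentSpace I x) : ricci x u v = ricci x v u := by
  let b := stdOrthonormalBasis ℝ (TangentSpace I x)
  rw [ricci_eq_sum b, ricci_eq_sum b]
  refine Finset.sum_congr rfl fun i _ ↦ ?_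
  rw [riem_pair_symm, riem_swap_left, riem_swap_right, neg_neg]

theorem inner_ricciEndo (u v : TangentSpace I x) : ⟪ricciEndo x u, v⟫_ℝ = ricci x u v := by
  let b := stdOrthonormalBasis ℝ (TangentSpace I x)
  let A : TangentSpace I x →ₗ[ℝ] ℝ := (innerₗ (TangentSpace I x)).flip v ∘ₗ ricciEndo x
  suffices h : A = (ricciLin x).flip v from LinearMap.congr_fun h u
  refine b.toBasis.ext fun i ↦ ?_
  have h1 : ricciEndo x (b i) = ∑ j, ricci x (b i) (b j) • b j := by
    have := b.toBasis.constr_basis ℝ (fun i ↦ ∑ j, ricci x (b i) (b j) • b j) i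
    rwa [OrthonormalBasis.coe_toBasis] at this
  have h2 : ricci x (b i) v = ∑ j, ⟪b j, v⟫_ℝ * ricci x (b i) (b j) := by
    conv_lhs => rw [← b.sum_repr' v, ← ricciLin_apply]
    simp [ricciLin_apply]
  simp only [A, OrthonormalBasis.coe_toBasis, LinearMap.comp_apply, LinearMap.flip_apply,
    innerₗ_apply_apply, h1, ricciLin_apply, sum_inner, inner_smul_left, h2]
  exact Finset.sum_congr rfl fun j _ ↦ mul_comm _ _

theorem ricciEndo_isSymmetric (u v : TangentSpace I x) :
    ⟪ricciEndo x u, v⟫_ℝ = ⟪u, ricciEndo x v⟫_ℝ := by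
  rw [inner_ricciEndo, ricci_symm, ← inner_ricciEndo, real_inner_comm]

theorem scalarCurvature_eq_sum {ι : Type*} [Fintype ι]
    (b : OrthonormalBasis ι ℝ (TangentSpace I x)) :
    scalarCurvature I x = ∑ i, ricci x (b i) (b i) := by
  rw [scalarCurvature, LinearMap.trace_eq_sum_inner _ b]
  simp only [← inner_ricciEndo, real_inner_comm]

variable {X Y Z W : Π x : M, TangentSpace I x}

theorem SmoothAt.riem (hX : SmoothAt X x) (hY : SmoothAt Y x) (hZ : SmoothAt Z x)
    (hW : SmoothAt W x) : SmoothFunAt I (fun y ↦ riem y (X y) (Y y) (Z y) (W y)) x := by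
  refine ((hX.curvatureOp hY hZ).inner hW).congr ?_
  filter_upwards [hX.eventually, hY.eventually, hZ.eventually] with y h1 h2 h3
  rw [GrayManifold.riem, curvature_eq_curvatureOp h1 h2 h3]

theorem IsOrthonormalFrameAt.ricci_eq_sum {ι : Type*} [Fintype ι]
    {e : ι → Π x : M, TangentSpace I x} (he : IsOrthonormalFrameAt e x) (u v : TangentSpace I x) :
    ricci x u v = ∑ i, GrayManifold.riem x (e i x) u v (e i x) := by
  obtain ⟨b, hb⟩ := he.exists_basis
  simp [GrayManifold.ricci_eq_sum b, hb]

theorem IsOrthonormalFrameAt.scalarCurvature_eq_sum {ι : Type*} [Fintype ι]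
    {e : ι → Π x : M, TangentSpace I x} (he : IsOrthonormalFrameAt e x) :
    scalarCurvature I x = ∑ i, ricci x (e i x) (e i x) := by
  obtain ⟨b, hb⟩ := he.exists_basis
  simp [GrayManifold.scalarCurvature_eq_sum b, hb]

theorem SmoothAt.ricci (hX : SmoothAt X x) (hY : SmoothAt Y x) :
    SmoothFunAt I (fun y ↦ ricci y (X y) (Y y)) x := by
  obtain ⟨e, he⟩ := exists_isOrthonormalFrameAt (I := I) x
  refine (SmoothFunAt.sum (s := Finset.univ) fun i _ ↦
    (he.smoothAt i).riem hX hY (he.smoothAt i)).congr ?_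
  filter_upwards [he.eventually] with y hy using hy.ricci_eq_sum _ _

theorem SmoothAt.ricciEndo (hX : SmoothAt X x) : SmoothAt (fun y ↦ ricciEndo y (X y)) x := by
  refine smoothAt_of_forall_inner fun Z hZ ↦ ?_
  simpa only [inner_ricciEndo] using hX.ricci hZ

theorem smoothFunAt_scalarCurvature (x : M) : SmoothFunAt I (scalarCurvature I) x := by
  obtain ⟨e, he⟩ := exists_isOrthonormalFrameAt (I := I) x
  refine (SmoothFunAt.sum (s := Finset.univ) fun i _ ↦
    (he.smoothAt i).ricci (he.smoothAt i)).congr ?_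
  filter_upwards [he.eventually] with y hy using hy.scalarCurvature_eq_sum

end Curvature

/-! ### The second Bianchi identity and its contraction. -/

section Bianchi

variable {E : Type*} [NormedAddCommGroup E] [NormedSpace ℝ E] [FiniteDimensional ℝ E]
  {H : Type*} [TopologicalSpace H] {I : ModelWithCorners ℝ E H}
  {M : Type*} [TopologicalSpace M] [ChartedSpace H M] [IsManifold I ∞ M]
  [RiemannianBundle (fun x : M ↦ TangentSpace I x)]
  [IsContMDiffRiemannianBundle I ∞ E (fun x : M ↦ TangentSpace I x)]

variable {x : M} {X Y Z W V : Π x : M, TangentSpace I x}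

theorem nabla_nabla_sub (hY : SmoothAt Y x) (hZ : SmoothAt Z x) (hW : SmoothAt W x) :
    nabla X (curvatureOp Y Z W) x = nabla X (nabla Y (nabla Z W)) x -
      nabla X (nabla Z (nabla Y W)) x - nabla X (nabla (mlieBracket I Y Z) W) x := by
  have h1 := hY.nabla (hZ.nabla hW)
  have h2 := hZ.nabla (hY.nabla hW)
  rw [curvatureOp, nabla_sub_right (h1.sub h2) ((hY.mlieBracket hZ).nabla hW),
    nabla_sub_right h1 h2]

/-- By torsion-freeness and tensoriality the two terms merge into `R([X, Y], Z) W`, so that the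
cyclic sum below involves only brackets. -/
theorem curvatureOp_nabla_sub (hX : SmoothAt X x) (hY : SmoothAt Y x) (hZ : SmoothAt Z x)
    (hW : SmoothAt W x) :
    curvatureOp (nabla X Y) Z W x + curvatureOp Z (nabla Y X) W x =
      nabla (mlieBracket I X Y) (nabla Z W) x - nabla Z (nabla (mlieBracket I X Y) W) x -
        nabla (mlieBracket I (mlieBracket I X Y) Z) W x := by
  rw [curvatureOp_swap (X := Z), Pi.neg_apply, ← curvatureOp_apply,
    ← curvature_eq_curvatureOp (hX.nabla hY) hZ hW, ← curvature_eq_curvatureOp (hY.nabla hX) hZ hW,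
    ← curvature_eq_curvatureOp (hX.mlieBracket hY) hZ hW, ← nabla_sub_nabla hX hY]
  simp only [← curvatureLin_apply, map_sub, LinearMap.sub_apply]
  rw [sub_eq_add_neg]

/-- The second Bianchi identity, for the curvature operator on vector fields. -/
theorem curvatureOp_second_bianchi (hX : SmoothAt X x) (hY : SmoothAt Y x) (hZ : SmoothAt Z x)
    (hW : SmoothAt W x) :
    (nabla X (curvatureOp Y Z W) x - curvatureOp (nabla X Y) Z W x -
        curvatureOp Y (nabla X Z) W x - curvatureOp Y Z (nabla X W) x) +
      (nabla Y (curvatureOp Z X W) x - curvatureOp (nabla Y Z) X W x -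
        curvatureOp Z (nabla Y X) W x - curvatureOp Z X (nabla Y W) x) +
      (nabla Z (curvatureOp X Y W) x - curvatureOp (nabla Z X) Y W x -
        curvatureOp X (nabla Z Y) W x - curvatureOp X Y (nabla Z W) x) = 0 := by
  have h1 := curvatureOp_nabla_sub hX hY hZ hW
  have h2 := curvatureOp_nabla_sub hY hZ hX hW
  have h3 := curvatureOp_nabla_sub hZ hX hY hW
  -- The third covariant derivatives cancel in the cyclic sum; what remains is `∇ W` along this
  -- Jacobi sum.
  have hJ : nabla (mlieBracket I (mlieBracket I X Y) Z) W x +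
      nabla (mlieBracket I (mlieBracket I Y Z) X) W x +
      nabla (mlieBracket I (mlieBracket I Z X) Y) W x = 0 := by
    simp only [nabla, ← map_add]
    have h4 := leibniz_mlieBracket hX hY hZ
    rw [mlieBracket_swap_apply (V := X), mlieBracket_swap_apply (V := Y) (W := mlieBracket I X Z),
      mlieBracket_swap (V := X) (W := Z)] at h4
    have h5 : mlieBracket I (-mlieBracket I Z X) Y x = -mlieBracket I (mlieBracket I Z X) Y x := by
      have := mlieBracket_const_smul_left (W := Y) (c := (-1 : ℝ)) (hZ.mlieBracket hX).mdiff
      rwa [neg_one_smul, neg_one_smul] at this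
    rw [h5, neg_neg] at h4
    rw [show mlieBracket I (mlieBracket I X Y) Z x + mlieBracket I (mlieBracket I Y Z) X x +
      mlieBracket I (mlieBracket I Z X) Y x = 0 by
        linear_combination (norm := module) -h4, map_zero]
  rw [nabla_nabla_sub hY hZ hW, nabla_nabla_sub hZ hX hW, nabla_nabla_sub hX hY hW,
    curvatureOp_apply (X := Y) (Y := Z) (Z := nabla X W),
    curvatureOp_apply (X := Z) (Y := X) (Z := nabla Y W),
    curvatureOp_apply (X := X) (Y := Y) (Z := nabla Z W)]
  linear_combination (norm := module) -h1 - h2 - h3 + hJ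

variable (X Y Z W V x) in
/-- The covariant derivative `(∇_X R)(Y, Z, W, V)` of the curvature tensor at `x`. -/
def nablaRiem : ℝ :=
  d% (fun y ↦ riem y (Y y) (Z y) (W y) (V y)) x (X x) - riem x (nabla X Y x) (Z x) (W x) (V x) -
    riem x (Y x) (nabla X Z x) (W x) (V x) - riem x (Y x) (Z x) (nabla X W x) (V x) -
    riem x (Y x) (Z x) (W x) (nabla X V x)

/-- Metric compatibility absorbs the `∇_X V` term, which carries the Bianchi identity over from the
operator to the `(0,4)`-tensor. -/
theorem nablaRiem_eq_inner (hX : SmoothAt X x) (hY : SmoothAt Y x) (hZ : SmoothAt Z x)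
    (hW : SmoothAt W x) (hV : SmoothAt V x) :
    nablaRiem x X Y Z W V = ⟪nabla X (curvatureOp Y Z W) x - curvatureOp (nabla X Y) Z W x -
      curvatureOp Y (nabla X Z) W x - curvatureOp Y Z (nabla X W) x, V x⟫_ℝ := by
  have h1 : (fun y ↦ riem y (Y y) (Z y) (W y) (V y)) =ᶠ[𝓝 x]
      fun y ↦ ⟪curvatureOp Y Z W y, V y⟫_ℝ := by
    filter_upwards [hY.eventually, hZ.eventually, hW.eventually] with y h1 h2 h3
    rw [riem, curvature_eq_curvatureOp h1 h2 h3]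
  rw [nablaRiem, mvfderiv_congr h1, mvfderiv_inner hX (hY.curvatureOp hZ hW) hV]
  simp only [riem, inner_sub_left, curvature_eq_curvatureOp (hX.nabla hY) hZ hW,
    curvature_eq_curvatureOp hY (hX.nabla hZ) hW, curvature_eq_curvatureOp hY hZ (hX.nabla hW),
    curvature_eq_curvatureOp hY hZ hW]
  ring

theorem nablaRiem_cyclic (hX : SmoothAt X x) (hY : SmoothAt Y x) (hZ : SmoothAt Z x)
    (hW : SmoothAt W x) (hV : SmoothAt V x) :
    nablaRiem x X Y Z W V + nablaRiem x Y Z X W V + nablaRiem x Z X Y W V = 0 := by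
  rw [nablaRiem_eq_inner hX hY hZ hW hV, nablaRiem_eq_inner hY hZ hX hW hV,
    nablaRiem_eq_inner hZ hX hY hW hV, ← inner_add_left, ← inner_add_left,
    curvatureOp_second_bianchi hX hY hZ hW, inner_zero_left]

theorem nablaRiem_swap_left : nablaRiem x X Y Z W V = -nablaRiem x X Z Y W V := by
  have h : (fun y ↦ riem y (Y y) (Z y) (W y) (V y)) =
      fun y ↦ -riem y (Z y) (Y y) (W y) (V y) := funext fun y ↦ riem_swap_left ..
  rw [nablaRiem, h, mvfderiv_fun_neg, riem_swap_left (Y x), riem_swap_left (Y x),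
    riem_swap_left (Y x), riem_swap_left (nabla X Y x), nablaRiem]
  simp only [neg_apply]
  ring

theorem nablaRiem_swap_right : nablaRiem x X Y Z W V = -nablaRiem x X Y Z V W := by
  have h : (fun y ↦ riem y (Y y) (Z y) (W y) (V y)) =
      fun y ↦ -riem y (Y y) (Z y) (V y) (W y) := funext fun y ↦ riem_swap_right ..
  rw [nablaRiem, h, mvfderiv_fun_neg, nablaRiem, riem_swap_right (nabla X Y x),
    riem_swap_right (Y x) (nabla X Z x), riem_swap_right _ _ (nabla X W x),
    riem_swap_right _ _ (W x)]
  simp only [neg_apply]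
  ring

variable (X Z W x) in
/-- The covariant derivative `(∇_X ρ)(Z, W)` of the Ricci tensor at `x`. -/
def nablaRicci : ℝ :=
  d% (fun y ↦ ricci y (Z y) (W y)) x (X x) - ricci x (nabla X Z x) (W x) -
    ricci x (Z x) (nabla X W x)

theorem nablaRicci_eq_inner (hX : SmoothAt X x) (hZ : SmoothAt Z x) (hW : SmoothAt W x) :
    nablaRicci x X Z W =
      ⟪nabla X (fun y ↦ ricciEndo y (Z y)) x - ricciEndo x (nabla X Z x), W x⟫_ℝ := by
  have h := mvfderiv_inner hX hZ.ricciEndo hW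
  simp only [inner_ricciEndo] at h
  rw [nablaRicci, h, inner_sub_left, inner_ricciEndo]
  ring

theorem nablaRicci_symm : nablaRicci x X Z W = nablaRicci x X W Z := by
  have h : (fun y ↦ ricci y (Z y) (W y)) = fun y ↦ ricci y (W y) (Z y) :=
    funext fun y ↦ ricci_symm ..
  rw [nablaRicci, h, nablaRicci, ricci_symm (nabla X Z x), ricci_symm _ (nabla X W x)]
  ring

theorem mvfderiv_fun_sum {ι : Type*} (s : Finset ι) {f : ι → M → ℝ}
    (hf : ∀ i, SmoothFunAt I (f i) x) (v : TangentSpace I x) :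
    d% (fun y ↦ ∑ i ∈ s, f i y) x v = ∑ i ∈ s, d% (f i) x v := by
  classical
  induction s using Finset.induction_on with
  | empty => simp [mvfderiv_const]
  | insert a s ha ih =>
    simp only [Finset.sum_insert ha]
    rw [mvfderiv_fun_add (hf a).mdiff (SmoothFunAt.sum fun i _ ↦ hf i).mdiff, add_apply, ih]

namespace IsOrthonormalFrameAt

variable {ι : Type*} [Fintype ι] {e : ι → Π x : M, TangentSpace I x}

/-- The functions `⟪e i, e j⟫` are constant near `x`. -/
theorem inner_nabla_skew (he : IsOrthonormalFrameAt e x) (hX : SmoothAt X x) (i j : ι) :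
    ⟪nabla X (e i) x, e j x⟫_ℝ = -⟪nabla X (e j) x, e i x⟫_ℝ := by
  classical
  have h1 := mvfderiv_inner hX (he.smoothAt i) (he.smoothAt j)
  have h2 : (fun y ↦ ⟪e i y, e j y⟫_ℝ) =ᶠ[𝓝 x] fun _ ↦ if i = j then 1 else 0 := by
    filter_upwards [he.eventually] with y hy using hy.inner_eq i j
  rw [mvfderiv_congr h2, mvfderiv_const, real_inner_comm (nabla X (e j) x)] at h1
  simp only [zero_apply] at h1
  linarith

/-- The trace of a bilinear form in an orthonormal frame is parallel. -/
theorem sum_bilin_nabla (he : IsOrthonormalFrameAt e x) (hX : SmoothAt X x)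
    (B : TangentSpace I x →ₗ[ℝ] TangentSpace I x →ₗ[ℝ] ℝ) :
    ∑ i, (B (nabla X (e i) x) (e i x) + B (e i x) (nabla X (e i) x)) = 0 := by
  have h (i) : nabla X (e i) x = ∑ j, ⟪e j x, nabla X (e i) x⟫_ℝ • e j x :=
    (he.sum_inner_smul _).symm
  have h1 : ∑ i, B (nabla X (e i) x) (e i x) =
      ∑ i, ∑ j, ⟪e j x, nabla X (e i) x⟫_ℝ * B (e j x) (e i x) := by
    refine Finset.sum_congr rfl fun i _ ↦ ?_
    conv_lhs => rw [h i]
    simp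
  have h2 : ∑ i, B (e i x) (nabla X (e i) x) =
      ∑ i, ∑ j, ⟪e j x, nabla X (e i) x⟫_ℝ * B (e i x) (e j x) := by
    refine Finset.sum_congr rfl fun i _ ↦ ?_
    conv_lhs => rw [h i]
    simp
  -- After exchanging the indices in one sum, each `B(e_i, e_j)` is multiplied by a symmetrized
  -- connection coefficient, which is zero.
  rw [Finset.sum_add_distrib, h1, h2, Finset.sum_comm, ← Finset.sum_add_distrib]
  refine Finset.sum_eq_zero fun i _ ↦ ?_
  rw [← Finset.sum_add_distrib]
  refine Finset.sum_eq_zero fun j _ ↦ ?_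
  have := he.inner_nabla_skew hX i j
  rw [real_inner_comm _ (e i x), real_inner_comm _ (e j x), this]
  ring

/-- Contraction commutes with `∇`: the terms in which the frame itself is differentiated cancel by
`sum_bilin_nabla`. -/
theorem sum_nablaRiem (he : IsOrthonormalFrameAt e x) (hX : SmoothAt X x) (hZ : SmoothAt Z x)
    (hW : SmoothAt W x) : ∑ i, nablaRiem x X (e i) Z W (e i) = nablaRicci x X Z W := by
  have h1 : (fun y ↦ ricci y (Z y) (W y)) =ᶠ[𝓝 x]
      fun y ↦ ∑ i, riem y (e i y) (Z y) (W y) (e i y) := by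
    filter_upwards [he.eventually] with y hy using hy.ricci_eq_sum _ _
  have h2 : ∑ i, (riem x (nabla X (e i) x) (Z x) (W x) (e i x) +
      riem x (e i x) (Z x) (W x) (nabla X (e i) x)) = 0 :=
    he.sum_bilin_nabla hX (LinearMap.mk₂ ℝ (fun u v ↦ riem x u (Z x) (W x) v)
    (fun u u' v ↦ by simp [riem, ← curvatureLin_apply, inner_add_left])
    (fun c u v ↦ by simp [riem, ← curvatureLin_apply, inner_smul_left])
    (fun u v v' ↦ by simp [riem, inner_add_right])
    (fun c u v ↦ by simp [riem, inner_smul_right]))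
  rw [Finset.sum_add_distrib] at h2
  rw [nablaRicci, mvfderiv_congr h1, mvfderiv_fun_sum _ fun i ↦
    (he.smoothAt i).riem hZ hW (he.smoothAt i), he.ricci_eq_sum, he.ricci_eq_sum]
  simp only [nablaRiem, Finset.sum_sub_distrib]
  linarith

theorem sum_nablaRicci (he : IsOrthonormalFrameAt e x) (hX : SmoothAt X x) :
    ∑ i, nablaRicci x X (e i) (e i) = mvfderiv I (scalarCurvature I) x (X x) := by
  have h1 : scalarCurvature I =ᶠ[𝓝 x] fun y ↦ ∑ i, ricci y (e i y) (e i y) := by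
    filter_upwards [he.eventually] with y hy using hy.scalarCurvature_eq_sum
  have h2 := he.sum_bilin_nabla hX (ricciLin x)
  simp only [ricciLin_apply, Finset.sum_add_distrib] at h2
  rw [mvfderiv_congr h1, mvfderiv_fun_sum _ fun i ↦ (he.smoothAt i).ricci (he.smoothAt i)]
  simp only [nablaRicci, Finset.sum_sub_distrib]
  linarith

/-- The contracted second Bianchi identity: twice the divergence of the Ricci tensor is the
differential of the scalar curvature. -/
theorem mvfderiv_scalarCurvature (he : IsOrthonormalFrameAt e x) (hZ : SmoothAt Z x) :
    mvfderiv I (scalarCurvature I) x (Z x) = 2 * ∑ i, nablaRicci x (e i) (e i) Z := by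
  -- Double trace of the second Bianchi identity: the first sum is `dτ(Z)`, each of the other two is
  -- minus the divergence of `ρ`.
  have h1 : ∑ i, ∑ j, (nablaRiem x Z (e i) (e j) (e j) (e i) +
      nablaRiem x (e i) (e j) Z (e j) (e i) + nablaRiem x (e j) Z (e i) (e j) (e i)) = 0 :=
    Finset.sum_eq_zero fun i _ ↦ Finset.sum_eq_zero fun j _ ↦
      nablaRiem_cyclic hZ (he.smoothAt i) (he.smoothAt j) (he.smoothAt j) (he.smoothAt i)
  simp only [Finset.sum_add_distrib] at h1
  have h2 : ∑ i, ∑ j, nablaRiem x Z (e i) (e j) (e j) (e i) =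
      mvfderiv I (scalarCurvature I) x (Z x) := by
    rw [Finset.sum_comm, ← he.sum_nablaRicci hZ]
    exact Finset.sum_congr rfl fun j _ ↦ he.sum_nablaRiem hZ (he.smoothAt j) (he.smoothAt j)
  have h3 : ∑ i, ∑ j, nablaRiem x (e i) (e j) Z (e j) (e i) =
      -∑ i, nablaRicci x (e i) (e i) Z := by
    rw [← Finset.sum_neg_distrib]
    refine Finset.sum_congr rfl fun i _ ↦ ?_
    rw [nablaRicci_symm, ← he.sum_nablaRiem (he.smoothAt i) hZ (he.smoothAt i),
      ← Finset.sum_neg_distrib]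
    exact Finset.sum_congr rfl fun j _ ↦ nablaRiem_swap_right
  have h4 : ∑ i, ∑ j, nablaRiem x (e j) Z (e i) (e j) (e i) =
      -∑ i, nablaRicci x (e i) (e i) Z := by
    rw [Finset.sum_comm, ← Finset.sum_neg_distrib]
    refine Finset.sum_congr rfl fun i _ ↦ ?_
    rw [nablaRicci_symm, ← he.sum_nablaRiem (he.smoothAt i) hZ (he.smoothAt i),
      ← Finset.sum_neg_distrib]
    exact Finset.sum_congr rfl fun j _ ↦ nablaRiem_swap_left
  rw [h2, h3, h4] at h1
  linarith

end IsOrthonormalFrameAt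

end Bianchi

/-! ### Covariant derivatives of endomorphism fields; sections of distributions. -/

section Killing

variable {E : Type*} [NormedAddCommGroup E] [NormedSpace ℝ E] [FiniteDimensional ℝ E]
  {H : Type*} [TopologicalSpace H] {I : ModelWithCorners ℝ E H}
  {M : Type*} [TopologicalSpace M] [ChartedSpace H M] [IsManifold I ∞ M]
  [RiemannianBundle (fun x : M ↦ TangentSpace I x)]
  [IsContMDiffRiemannianBundle I ∞ E (fun x : M ↦ TangentSpace I x)]

variable {x : M}

section Endomorphism

variable {S : Π x : M, TangentSpace I x →ₗ[ℝ] TangentSpace I x}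

/-- The `df` terms cancel, so the right side is tensorial in `V`. The chosen extension may thus be
replaced by a section of an eigendistribution. -/
theorem covDerivEndo_eq_nabla {X V : Π x : M, TangentSpace I x}
    (hS : ∀ V : Π x : M, TangentSpace I x, SmoothAt V x → SmoothAt (fun y ↦ S y (V y)) x)
    (hV : SmoothAt V x) :
    covDerivEndo S x (X x) (V x) = nabla X (fun y ↦ S y (V y)) x - S x (nabla X V x) := by
  refine eq_of_smooth_linear
    (Φ := fun V ↦ nabla X (fun y ↦ S y (V y)) x - S x (nabla X V x)) (fun V W hV hW ↦ ?_)
    (fun f V hf hV ↦ ?_) (SmoothAt.extend (V x)) hV (by simp)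
  · have h : (fun y ↦ S y ((V + W) y)) = (fun y ↦ S y (V y)) + fun y ↦ S y (W y) := by
      funext y; simp
    rw [h, nabla_add_right (hS V hV) (hS W hW), nabla_add_right hV hW, map_add]
    abel
  · have h : (fun y ↦ S y ((f • V) y)) = f • fun y ↦ S y (V y) := by
      funext y; simp
    rw [h, nabla_smul_right hf (hS V hV), nabla_smul_right hf hV, map_add, map_smul, map_smul]
    module

theorem covDerivEndo_add_left (u u' v : TangentSpace I x) :
    covDerivEndo S x (u + u') v = covDerivEndo S x u v + covDerivEndo S x u' v := by
  simp only [covDerivEndo, map_add]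
  abel

theorem covDerivEndo_add_right
    (hS : ∀ V : Π x : M, TangentSpace I x, SmoothAt V x → SmoothAt (fun y ↦ S y (V y)) x)
    (u v v' : TangentSpace I x) :
    covDerivEndo S x u (v + v') = covDerivEndo S x u v + covDerivEndo S x u v' := by
  set X := FiberBundle.extend E u
  set V := FiberBundle.extend E v
  set V' := FiberBundle.extend E v'
  have hV : SmoothAt V x := SmoothAt.extend v
  have hV' : SmoothAt V' x := SmoothAt.extend v'
  have h1 := covDerivEndo_eq_nabla (X := X) hS hV
  have h2 := covDerivEndo_eq_nabla (X := X) hS hV'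
  have h3 := covDerivEndo_eq_nabla (X := X) hS (hV.add hV')
  have h : (fun y ↦ S y ((V + V') y)) = (fun y ↦ S y (V y)) + fun y ↦ S y (V' y) := by
    funext y; simp
  rw [h, nabla_add_right (hS V hV) (hS V' hV'), nabla_add_right hV hV', map_add] at h3
  simp only [Pi.add_apply, X, V, V', FiberBundle.extend_apply_self] at h1 h2 h3
  rw [h1, h2, h3]
  abel

/-- Differentiate `⟪S V, W⟫ = ⟪S W, V⟫` along `u`. -/
theorem inner_covDerivEndo_symm
    (hS : ∀ V : Π x : M, TangentSpace I x, SmoothAt V x → SmoothAt (fun y ↦ S y (V y)) x)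
    (hsymm : ∀ (y : M) (v w : TangentSpace I y), ⟪S y v, w⟫_ℝ = ⟪v, S y w⟫_ℝ)
    (u v w : TangentSpace I x) :
    ⟪covDerivEndo S x u v, w⟫_ℝ = ⟪covDerivEndo S x u w, v⟫_ℝ := by
  set X := FiberBundle.extend E u
  set V := FiberBundle.extend E v
  set W := FiberBundle.extend E w
  have hX : SmoothAt X x := SmoothAt.extend u
  have hV : SmoothAt V x := SmoothAt.extend v
  have hW : SmoothAt W x := SmoothAt.extend w
  have h1 := covDerivEndo_eq_nabla (X := X) hS hV
  have h2 := covDerivEndo_eq_nabla (X := X) hS hW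
  have h3 := mvfderiv_inner hX (hS V hV) hW
  have h4 := mvfderiv_inner hX (hS W hW) hV
  have h5 : (fun y ↦ ⟪S y (V y), W y⟫_ℝ) = fun y ↦ ⟪S y (W y), V y⟫_ℝ := by
    funext y; rw [hsymm, real_inner_comm]
  rw [h5, h4] at h3
  have hVx : V x = v := by simp [V]
  have hWx : W x = w := by simp [W]
  have hXx : X x = u := by simp [X]
  rw [hVx, hXx] at h1
  rw [hWx, hXx] at h2
  rw [hVx, hWx] at h3
  rw [h1, h2, inner_sub_left, inner_sub_left, hsymm x (nabla X V x), hsymm x (nabla X W x),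
    real_inner_comm (S x w), real_inner_comm (S x v)]
  linarith

/-- The covariant derivative of a symmetric endomorphism on eigenvectors. -/
theorem inner_covDerivEndo_of_eigen {V : Π x : M, TangentSpace I x} {p : M → ℝ} {q : ℝ}
    {w : TangentSpace I x}
    (hS : ∀ V : Π x : M, TangentSpace I x, SmoothAt V x → SmoothAt (fun y ↦ S y (V y)) x)
    (hsymm : ∀ v w : TangentSpace I x, ⟪S x v, w⟫_ℝ = ⟪v, S x w⟫_ℝ)
    (hV : SmoothAt V x) (hp : SmoothFunAt I p x) (hSV : ∀ᶠ y in 𝓝 x, S y (V y) = p y • V y)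
    (hw : S x w = q • w) (u : TangentSpace I x) :
    ⟪covDerivEndo S x u (V x), w⟫_ℝ =
      d% p x u * ⟪V x, w⟫_ℝ + (p x - q) * ⟪leviCivita V x u, w⟫_ℝ := by
  have h1 := covDerivEndo_eq_nabla (X := FiberBundle.extend E u) hS hV
  -- Leibniz for `S V = p V` near `x`; moving `S x` onto `w` in the remaining term brings out `q`.
  rw [nabla_congr (hS V hV) (SmoothAt.smul hp hV) hSV, nabla_smul_right hp hV] at h1
  simp only [nabla, FiberBundle.extend_apply_self] at h1
  rw [h1, inner_sub_left, inner_add_left, inner_smul_left, inner_smul_left, hsymm, hw,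
    inner_smul_right]
  simp only [RCLike.conj_to_real]
  ring

end Endomorphism

section Distribution

variable {D : Π x : M, Submodule ℝ (TangentSpace I x)}

theorem IsSmoothDistribution.exists_orthonormal (hD : IsSmoothDistribution D) {d : ℕ}
    (hd : finrank ℝ (D x) = d) :
    ∃ e : Fin d → Π x : M, TangentSpace I x, (∀ i, SmoothAt (e i) x) ∧
      ∀ᶠ y in 𝓝 x, Orthonormal ℝ (fun i ↦ e i y) ∧
        Submodule.span ℝ (Set.range fun i ↦ e i y) = D y := by
  obtain ⟨U, hU, hxU, k, X, hX, hspan⟩ := hD x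
  obtain rfl : k = d := by
    rw [← hd, ← (hspan x hxU).2, finrank_span_eq_card (hspan x hxU).1, Fintype.card_fin]
  have hUx : ∀ᶠ y in 𝓝 x, y ∈ U := hU.mem_nhds hxU
  obtain ⟨e, h1, h2⟩ := exists_orthonormal_span_eq
    (fun i ↦ SmoothAt.of_contMDiffOn hU (hX i) hxU) (hUx.mono fun y hy ↦ (hspan y hy).1)
  refine ⟨e, h1, ?_⟩
  filter_upwards [h2, hUx] with y hy hyU using ⟨hy.1, hy.2.trans (hspan y hyU).2⟩

/-- Constant coefficients in a local frame of `D`. -/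
theorem IsSmoothDistribution.exists_section (hD : IsSmoothDistribution D) {v : TangentSpace I x}
    (hv : v ∈ D x) : ∃ V : Π x : M, TangentSpace I x, SmoothAt V x ∧ V x = v ∧
      ∀ᶠ y in 𝓝 x, V y ∈ D y := by
  obtain ⟨e, h1, h2⟩ := hD.exists_orthonormal (x := x) rfl
  rw [← h2.self_of_nhds.2, Submodule.mem_span_range_iff_exists_fun] at hv
  obtain ⟨c, hc⟩ := hv
  refine ⟨fun y ↦ ∑ i, ((fun _ ↦ c i) • e i) y,
    SmoothAt.sum fun i _ ↦ SmoothAt.smul (SmoothFunAt.const (c i)) (h1 i), hc, ?_⟩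
  filter_upwards [h2] with y hy
  rw [← hy.2, Submodule.mem_span_range_iff_exists_fun]
  exact ⟨c, rfl⟩

theorem SmoothAt.exists_isSectionOn {V : Π x : M, TangentSpace I x} (hV : SmoothAt V x)
    (h : ∀ᶠ y in 𝓝 x, V y ∈ D y) : ∃ U : Set M, IsOpen U ∧ x ∈ U ∧ IsSectionOn D U V := by
  obtain ⟨U, h1, h2, h3⟩ := eventually_nhds_iff.1 (hV.and h)
  exact ⟨U, h2, h3, fun y hy ↦ (h1 y hy).1.contMDiffWithinAt, fun y hy ↦ (h1 y hy).2⟩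

end Distribution

theorem inner_grad (f : M → ℝ) (v : TangentSpace I x) : ⟪grad I f x, v⟫_ℝ = d% f x v := by
  have : CompleteSpace (TangentSpace I x) := FiniteDimensional.complete ℝ _
  rw [grad, InnerProductSpace.toDual_symm_apply]

/-- In a chart the derivative vanishes on a ball, which is convex. Without boundary the chart target
is open in `E`, so such a ball exists. -/
theorem isLocallyConstant_of_mvfderiv_eq_zero [I.Boundaryless] {f : M → ℝ}
    (hf : ∀ x, MDiffAt f x) (h : ∀ x, mvfderiv I f x = 0) : IsLocallyConstant f := by
  refine (IsLocallyConstant.iff_eventually_eq f).2 fun x ↦ ?_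
  obtain ⟨r, hr, hball⟩ := Metric.isOpen_iff.1 (isOpen_extChartAt_target (I := I) x) _
    (mem_extChartAt_target x)
  have hg : ∀ z ∈ Metric.ball (extChartAt I x x) r,
      HasFDerivAt (f ∘ (extChartAt I x).symm) (0 : E →L[ℝ] ℝ) z := by
    intro z hz
    have h1 : MDifferentiableAt 𝓘(ℝ, E) I (extChartAt I x).symm z :=
      (contMDiffOn_extChartAt_symm (I := I) (n := ∞) x).contMDiffAt
        ((isOpen_extChartAt_target (I := I) x).mem_nhds (hball hz)) |>.mdifferentiableAt (by simp)
    have h2 := (hf ((extChartAt I x).symm z)).hasMFDerivAt.comp z h1.hasMFDerivAt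
    have h3 : mfderiv I 𝓘(ℝ, ℝ) f ((extChartAt I x).symm z) = 0 := h _
    rw [h3, ContinuousLinearMap.zero_comp] at h2
    exact h2.hasFDerivAt
  have h2 : ∀ z ∈ Metric.ball (extChartAt I x x) r,
      (f ∘ (extChartAt I x).symm) z = (f ∘ (extChartAt I x).symm) (extChartAt I x x) := by
    intro z hz
    refine (convex_ball _ r).is_const_of_fderivWithin_eq_zero (𝕜 := ℝ)
      (fun w hw ↦ (hg w hw).differentiableAt.differentiableWithinAt) (fun w hw ↦ ?_) hz
      (Metric.mem_ball_self hr)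
    rw [fderivWithin_of_isOpen Metric.isOpen_ball hw, (hg w hw).fderiv]
  filter_upwards [(continuousAt_extChartAt (I := I) x).preimage_mem_nhds (Metric.ball_mem_nhds _ hr),
    extChartAt_source_mem_nhds (I := I) x] with y hy hys
  have := h2 _ hy
  simpa only [Function.comp_apply, (extChartAt I x).left_inv hys, extChartAt_to_inv] using this

end Killing

/-! ### The two Ricci eigendistributions. -/

section Splitting

variable {E : Type*} [NormedAddCommGroup E] [NormedSpace ℝ E] [FiniteDimensional ℝ E]
  {H : Type*} [TopologicalSpace H] {I : ModelWithCorners ℝ E H}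
  {M : Type*} [TopologicalSpace M] [ChartedSpace H M] [IsManifold I ∞ M]
  [RiemannianBundle (fun x : M ↦ TangentSpace I x)]
  [IsContMDiffRiemannianBundle I ∞ E (fun x : M ↦ TangentSpace I x)]

/-- The Ricci endomorphism has the eigenvalues `lam x ≠ mu x` on the smooth distributions `D` and
`D'` of ranks `d` and `d'`, whose sum is the dimension of the manifold. -/
structure IsRicciSplitting (lam mu : M → ℝ) (D D' : Π x : M, Submodule ℝ (TangentSpace I x))
    (d d' : ℕ) : Prop where
  ne : ∀ x, lam x ≠ mu x
  left : ∀ x, ∀ v ∈ D x, ricciEndo x v = lam x • v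
  right : ∀ x, ∀ v ∈ D' x, ricciEndo x v = mu x • v
  rank_left : ∀ x, finrank ℝ (D x) = d
  rank_right : ∀ x, finrank ℝ (D' x) = d'
  rank_add : d + d' = finrank ℝ E
  smooth_left : IsSmoothDistribution D
  smooth_right : IsSmoothDistribution D'

namespace IsRicciSplitting

variable {lam mu : M → ℝ} {D D' : Π x : M, Submodule ℝ (TangentSpace I x)} {d d' : ℕ} {x : M}

theorem symm (h : IsRicciSplitting lam mu D D' d d') : IsRicciSplitting mu lam D' D d' d :=
  ⟨fun x ↦ (h.ne x).symm, h.right, h.left, h.rank_right, h.rank_left,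
    (add_comm _ _).trans h.rank_add, h.smooth_right, h.smooth_left⟩

/-- Eigenvectors of a symmetric endomorphism for distinct eigenvalues are orthogonal. -/
theorem inner_eq_zero (h : IsRicciSplitting lam mu D D' d d') {v w : TangentSpace I x}
    (hv : v ∈ D x) (hw : w ∈ D' x) : ⟪v, w⟫_ℝ = 0 := by
  have h1 := ricciEndo_isSymmetric v w
  rw [h.left x v hv, h.right x w hw, inner_smul_left, inner_smul_right, RCLike.conj_to_real] at h1
  have h2 : (lam x - mu x) * ⟪v, w⟫_ℝ = 0 := by linarith
  exact (mul_eq_zero.1 h2).resolve_left (sub_ne_zero.2 (h.ne x))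

/-- Near every point there is a smooth orthonormal frame adapted to the splitting. -/
theorem exists_frame (h : IsRicciSplitting lam mu D D' d d') (x : M) :
    ∃ e : Fin d ⊕ Fin d' → Π x : M, TangentSpace I x, IsOrthonormalFrameAt e x ∧
      (∀ᶠ y in 𝓝 x, ∀ i, e (Sum.inl i) y ∈ D y) ∧ ∀ᶠ y in 𝓝 x, ∀ i, e (Sum.inr i) y ∈ D' y := by
  obtain ⟨e, h1, h2⟩ := h.smooth_left.exists_orthonormal (h.rank_left x)
  obtain ⟨e', h1', h2'⟩ := h.smooth_right.exists_orthonormal (h.rank_right x)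
  have hm : ∀ᶠ y in 𝓝 x, ∀ i, e i y ∈ D y :=
    h2.mono fun y hy i ↦ hy.2 ▸ Submodule.subset_span ⟨i, rfl⟩
  have hm' : ∀ᶠ y in 𝓝 x, ∀ i, e' i y ∈ D' y :=
    h2'.mono fun y hy i ↦ hy.2 ▸ Submodule.subset_span ⟨i, rfl⟩
  refine ⟨Sum.elim e e', ⟨?_, ?_⟩, hm, hm'⟩
  · rintro (i | i)
    exacts [h1 i, h1' i]
  · filter_upwards [h2, h2', hm, hm'] with y hy hy' hym hym'
    have ho : Orthonormal ℝ (fun i ↦ Sum.elim e e' i y) := by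
      refine ⟨?_, ?_⟩
      · rintro (i | i)
        exacts [hy.1.1 i, hy'.1.1 i]
      · rintro (i | i) (j | j) hij
        · exact hy.1.2 fun hc ↦ hij (congrArg _ hc)
        · exact h.inner_eq_zero (hym i) (hym' j)
        · exact h.symm.inner_eq_zero (hym' i) (hym j)
        · exact hy'.1.2 fun hc ↦ hij (congrArg _ hc)
    have hcard : Fintype.card (Fin d ⊕ Fin d') = finrank ℝ (TangentSpace I y) := by
      simpa using! h.rank_add
    have hspan := ho.linearIndependent.span_eq_top_of_card_eq_finrank' hcard
    exact ⟨OrthonormalBasis.mk ho hspan.ge, fun i ↦ by simp⟩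

theorem exists_add (h : IsRicciSplitting lam mu D D' d d') (v : TangentSpace I x) :
    ∃ a ∈ D x, ∃ b ∈ D' x, v = a + b := by
  obtain ⟨e, he, h1, h2⟩ := h.exists_frame x
  refine ⟨∑ i, ⟪e (Sum.inl i) x, v⟫_ℝ • e (Sum.inl i) x,
    Submodule.sum_mem _ fun i _ ↦ Submodule.smul_mem _ _ (h1.self_of_nhds i),
    ∑ i, ⟪e (Sum.inr i) x, v⟫_ℝ • e (Sum.inr i) x,
    Submodule.sum_mem _ fun i _ ↦ Submodule.smul_mem _ _ (h2.self_of_nhds i), ?_⟩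
  rw [← Fintype.sum_sum_type fun i ↦ ⟪e i x, v⟫_ℝ • e i x, he.sum_inner_smul]

theorem mem_left_of_inner_eq_zero (h : IsRicciSplitting lam mu D D' d d') {v : TangentSpace I x}
    (hv : ∀ w ∈ D' x, ⟪v, w⟫_ℝ = 0) : v ∈ D x := by
  obtain ⟨a, ha, b, hb, rfl⟩ := h.exists_add v
  have h1 := hv b hb
  rw [inner_add_left, h.inner_eq_zero ha hb, zero_add, inner_self_eq_zero] at h1
  rwa [h1, add_zero]

/-- Smoothness of the eigenvalue is not assumed: locally `lam = ρ(e, e)` for a smooth unit section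
`e` of `D`, which exists as the rank is positive. -/
theorem smoothFunAt_left (h : IsRicciSplitting lam mu D D' d d') (hd : 0 < d) (x : M) :
    SmoothFunAt I lam x := by
  obtain ⟨e, he, h1, -⟩ := h.exists_frame x
  let i : Fin d ⊕ Fin d' := Sum.inl ⟨0, hd⟩
  refine ((he.smoothAt i).ricci (he.smoothAt i)).congr ?_
  filter_upwards [he.eventually, h1] with y hy h1
  rw [← inner_ricciEndo, h.left y _ (h1 ⟨0, hd⟩), inner_smul_left, hy.inner_eq]
  simp [i]

theorem scalarCurvature_eq (h : IsRicciSplitting lam mu D D' d d') (x : M) :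
    scalarCurvature I x = d * lam x + d' * mu x := by
  obtain ⟨e, he, h1, h2⟩ := h.exists_frame x
  have h3 (i : Fin d) : ricci x (e (Sum.inl i) x) (e (Sum.inl i) x) = lam x := by
    rw [← inner_ricciEndo, h.left x _ (h1.self_of_nhds i), inner_smul_left, he.inner_eq]
    simp
  have h4 (i : Fin d') : ricci x (e (Sum.inr i) x) (e (Sum.inr i) x) = mu x := by
    rw [← inner_ricciEndo, h.right x _ (h2.self_of_nhds i), inner_smul_left, he.inner_eq]
    simp
  rw [he.scalarCurvature_eq_sum, Fintype.sum_sum_type]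
  simp [h3, h4]

theorem mvfderiv_scalarCurvature (h : IsRicciSplitting lam mu D D' d d') (hd : 0 < d)
    (hd' : 0 < d') (v : TangentSpace I x) :
    mvfderiv I (scalarCurvature I) x v = d * d% lam x v + d' * d% mu x v := by
  have h1 : scalarCurvature I = fun x : M ↦ d * lam x + d' * mu x := funext h.scalarCurvature_eq
  have hl := h.smoothFunAt_left hd x
  have hm := h.symm.smoothFunAt_left hd' x
  have hc (c : ℝ) := SmoothFunAt.const (I := I) (x := x) c
  rw [h1, mvfderiv_fun_add ((hc d).mul hl).mdiff ((hc d').mul hm).mdiff,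
    mvfderiv_fun_mul (hc d).mdiff hl.mdiff, mvfderiv_fun_mul (hc d').mdiff hm.mdiff]
  simp [mvfderiv_const]

/-- On an umbilical distribution, the mixed part of the covariant derivative is given by the mean
curvature normal. -/
theorem inner_nabla_self (h : IsRicciSplitting lam mu D D' d d')
    {ξ : Π x : M, TangentSpace I x}
    (hξ : ∀ (U : Set M) (X : Π x : M, TangentSpace I x), IsOpen U → IsSectionOn D' U X →
        ∀ x ∈ U, nabla X X x - ⟪X x, X x⟫_ℝ • ξ x ∈ D' x)
    {X : Π x : M, TangentSpace I x} (hX : SmoothAt X x) (hXD : ∀ᶠ y in 𝓝 x, X y ∈ D' y)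
    {a : TangentSpace I x} (ha : a ∈ D x) :
    ⟪nabla X X x, a⟫_ℝ = ⟪X x, X x⟫_ℝ * ⟪ξ x, a⟫_ℝ := by
  obtain ⟨U, hU, hxU, hs⟩ := hX.exists_isSectionOn hXD
  have h1 := h.symm.inner_eq_zero (hξ U X hU hs x hxU) ha
  rw [inner_sub_left, inner_smul_left, RCLike.conj_to_real] at h1
  linarith

/-- The mean curvature normal of an umbilical Ricci eigendistribution with totally geodesic
complement is determined by the differential of the eigenvalue. -/
theorem mvfderiv_right_of_isUmbilical (h : IsRicciSplitting lam mu D D' d d') (hd : d = 2)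
    (hd' : 0 < d') {ξ : Π x : M, TangentSpace I x}
    (hξ : ∀ (U : Set M) (X : Π x : M, TangentSpace I x), IsOpen U → IsSectionOn D' U X →
        ∀ x ∈ U, nabla X X x - ⟪X x, X x⟫_ℝ • ξ x ∈ D' x)
    {a : TangentSpace I x} (ha : a ∈ D x) :
    d% mu x a = 2 * (mu x - lam x) * ⟪ξ x, a⟫_ℝ := by
  have hlam := h.smoothFunAt_left (by omega) x
  have hmu := h.symm.smoothFunAt_left hd' x
  obtain ⟨A, hA, rfl, hAD⟩ := h.smooth_left.exists_section ha
  obtain ⟨e, he, h1, h2⟩ := h.exists_frame x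
  have hS : ∀ V : Π x : M, TangentSpace I x, SmoothAt V x → SmoothAt (fun y ↦ ricciEndo y (V y)) x :=
    fun V hV ↦ hV.ricciEndo
  have hB := he.mvfderiv_scalarCurvature hA
  rw [h.mvfderiv_scalarCurvature (by omega) hd', Fintype.sum_sum_type] at hB
  have hterm (j : Fin d ⊕ Fin d') : nablaRicci x (e j) (e j) A =
      ⟪covDerivEndo ricciEndo x (e j x) (e j x), A x⟫_ℝ := by
    rw [nablaRicci_eq_inner (he.smoothAt j) (he.smoothAt j) hA,
      covDerivEndo_eq_nabla hS (he.smoothAt j)]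
  -- Both arguments have eigenvalue `lam`, so the connection term has coefficient zero; summed over
  -- `i` these terms give `dλ(A)`.
  have hl (i : Fin d) : nablaRicci x (e (Sum.inl i)) (e (Sum.inl i)) A =
      d% lam x (⟪e (Sum.inl i) x, A x⟫_ℝ • e (Sum.inl i) x) := by
    rw [hterm, inner_covDerivEndo_of_eigen hS ricciEndo_isSymmetric (he.smoothAt _) hlam
      (h1.mono fun y hy ↦ h.left y _ (hy i)) (h.left x _ ha), map_smul, smul_eq_mul]
    ring
  have hr (i : Fin d') : nablaRicci x (e (Sum.inr i)) (e (Sum.inr i)) A =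
      (mu x - lam x) * ⟪ξ x, A x⟫_ℝ := by
    rw [hterm, inner_covDerivEndo_of_eigen hS ricciEndo_isSymmetric (he.smoothAt _) hmu
      (h2.mono fun y hy ↦ h.right y _ (hy i)) (h.left x _ ha),
      h.symm.inner_eq_zero (h2.self_of_nhds i) ha, ← nabla_apply,
      h.inner_nabla_self hξ (he.smoothAt _) (h2.mono fun y hy ↦ hy i) ha, he.inner_eq]
    simp
  have hsum : ∑ i, ⟪e (Sum.inl i) x, A x⟫_ℝ • e (Sum.inl i) x = A x := by
    have h3 := he.sum_inner_smul (A x)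
    rw [Fintype.sum_sum_type] at h3
    have h4 (i : Fin d') : ⟪e (Sum.inr i) x, A x⟫_ℝ = 0 :=
      h.symm.inner_eq_zero (h2.self_of_nhds i) ha
    simpa [h4] using h3
  simp only [hl, hr] at hB
  rw [← map_sum, hsum, Finset.sum_const, Finset.card_univ, Fintype.card_fin, nsmul_eq_mul] at hB
  -- Bianchi reads `d dλ(A) + d' dμ(A) = 2 dλ(A) + 2 d' (μ - λ) ⟪ξ, A⟫`; for `d = 2` the `dλ` terms
  -- cancel.
  subst hd
  have hd0 : (d' : ℝ) ≠ 0 := by exact_mod_cast hd'.ne'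
  refine mul_left_cancel₀ hd0 ?_
  push_cast at hB
  linarith

end IsRicciSplitting

end Splitting

/-! ### The Killing equations and the Gray condition. -/

section Gray

variable {E : Type*} [NormedAddCommGroup E] [NormedSpace ℝ E] [FiniteDimensional ℝ E]
  {H : Type*} [TopologicalSpace H] {I : ModelWithCorners ℝ E H}
  {M : Type*} [TopologicalSpace M] [ChartedSpace H M] [IsManifold I ∞ M]
  [RiemannianBundle (fun x : M ↦ TangentSpace I x)]
  [IsContMDiffRiemannianBundle I ∞ E (fun x : M ↦ TangentSpace I x)]

variable {x : M}

/-- Expansion of the cubic form by bidegree in `(a, b)`; symmetry of `∇_u S` merges equal mixed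
terms, whence the factors 2. -/
theorem inner_covDerivEndo_add_self {S : Π x : M, TangentSpace I x →ₗ[ℝ] TangentSpace I x}
    (hS : ∀ V : Π x : M, TangentSpace I x, SmoothAt V x → SmoothAt (fun y ↦ S y (V y)) x)
    (hsymm : ∀ (y : M) (v w : TangentSpace I y), ⟪S y v, w⟫_ℝ = ⟪v, S y w⟫_ℝ)
    (a b : TangentSpace I x) :
    ⟪covDerivEndo S x (a + b) (a + b), a + b⟫_ℝ =
      ⟪covDerivEndo S x a a, a⟫_ℝ + ⟪covDerivEndo S x b b, b⟫_ℝ +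
        (⟪covDerivEndo S x b a, a⟫_ℝ + 2 * ⟪covDerivEndo S x a a, b⟫_ℝ) +
        (⟪covDerivEndo S x a b, b⟫_ℝ + 2 * ⟪covDerivEndo S x b b, a⟫_ℝ) := by
  have h1 := inner_covDerivEndo_symm hS hsymm a b a
  have h2 := inner_covDerivEndo_symm hS hsymm b a b
  simp only [covDerivEndo_add_left, covDerivEndo_add_right hS, inner_add_left, inner_add_right]
  linarith

namespace IsRicciSplitting

variable {lam mu : M → ℝ} {D D' : Π x : M, Submodule ℝ (TangentSpace I x)} {d d' : ℕ}

theorem exists_ne_zero (h : IsRicciSplitting lam mu D D' d d') (hd : 0 < d) (x : M) :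
    ∃ a ∈ D x, a ≠ 0 := by
  refine (D x).exists_mem_ne_zero_of_ne_bot fun hbot ↦ ?_
  have := h.rank_left x
  rw [hbot, finrank_bot] at this
  omega

/-- A symmetric endomorphism with the eigendistributions `D`, `D'`, the first one totally geodesic
and the second one umbilical, is a Killing tensor if and only if its eigenvalues `p` and `q`
satisfy three differential equations. -/
theorem isKillingTensor_iff (h : IsRicciSplitting lam mu D D' d d') (hd : 0 < d) (hd' : 0 < d')
    (hgeod : IsTotallyGeodesicFoliation D) {ξ : Π x : M, TangentSpace I x}
    (hξ : ∀ (U : Set M) (X : Π x : M, TangentSpace I x), IsOpen U → IsSectionOn D' U X →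
        ∀ x ∈ U, nabla X X x - ⟪X x, X x⟫_ℝ • ξ x ∈ D' x)
    {S : Π x : M, TangentSpace I x →ₗ[ℝ] TangentSpace I x}
    (hS : ∀ (x : M) (V : Π x : M, TangentSpace I x), SmoothAt V x →
      SmoothAt (fun y ↦ S y (V y)) x)
    (hsymm : ∀ (y : M) (v w : TangentSpace I y), ⟪S y v, w⟫_ℝ = ⟪v, S y w⟫_ℝ)
    {p q : M → ℝ} (hp : ∀ x, SmoothFunAt I p x) (hq : ∀ x, SmoothFunAt I q x)
    (hSD : ∀ x, ∀ v ∈ D x, S x v = p x • v) (hSD' : ∀ x, ∀ v ∈ D' x, S x v = q x • v) :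
    IsKillingTensor S ↔ (∀ x, mvfderiv I p x = 0) ∧ (∀ x, ∀ b ∈ D' x, d% q x b = 0) ∧
      ∀ x, ∀ a ∈ D x, d% q x a = 2 * (p x - q x) * ⟪ξ x, a⟫_ℝ := by
  have hua (x : M) (u a : TangentSpace I x) (ha : a ∈ D x) :
      ⟪covDerivEndo S x u a, a⟫_ℝ = d% p x u * ⟪a, a⟫_ℝ := by
    obtain ⟨A, hA, rfl, hAD⟩ := h.smooth_left.exists_section ha
    rw [inner_covDerivEndo_of_eigen (hS x) (hsymm x) hA (hp x) (hAD.mono fun y hy ↦ hSD y _ hy)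
      (hSD x _ ha)]
    ring
  have hub (x : M) (u b : TangentSpace I x) (hb : b ∈ D' x) :
      ⟪covDerivEndo S x u b, b⟫_ℝ = d% q x u * ⟪b, b⟫_ℝ := by
    obtain ⟨B, hB, rfl, hBD⟩ := h.smooth_right.exists_section hb
    rw [inner_covDerivEndo_of_eigen (hS x) (hsymm x) hB (hq x) (hBD.mono fun y hy ↦ hSD' y _ hy)
      (hSD' x _ hb)]
    ring
  -- The only possible contribution is `(p - q) ⟪∇_A A, b⟫`, killed by total geodesy of `D`.
  have haab (x : M) (a b : TangentSpace I x) (ha : a ∈ D x) (hb : b ∈ D' x) :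
      ⟪covDerivEndo S x a a, b⟫_ℝ = 0 := by
    obtain ⟨A, hA, rfl, hAD⟩ := h.smooth_left.exists_section ha
    obtain ⟨U, hU, hxU, hs⟩ := hA.exists_isSectionOn hAD
    rw [inner_covDerivEndo_of_eigen (hS x) (hsymm x) hA (hp x) (hAD.mono fun y hy ↦ hSD y _ hy)
      (hSD' x _ hb), h.inner_eq_zero ha hb, ← nabla_apply,
      h.inner_eq_zero (hgeod.2 U A A hU hs hs x hxU).2 hb]
    ring
  have hbba (x : M) (a b : TangentSpace I x) (ha : a ∈ D x) (hb : b ∈ D' x) :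
      ⟪covDerivEndo S x b b, a⟫_ℝ = (q x - p x) * (⟪b, b⟫_ℝ * ⟪ξ x, a⟫_ℝ) := by
    obtain ⟨B, hB, rfl, hBD⟩ := h.smooth_right.exists_section hb
    rw [inner_covDerivEndo_of_eigen (hS x) (hsymm x) hB (hq x) (hBD.mono fun y hy ↦ hSD' y _ hy)
      (hSD x _ ha), h.symm.inner_eq_zero hb ha, ← nabla_apply, h.inner_nabla_self hξ hB hBD ha]
    ring
  have hadd (x : M) (a b : TangentSpace I x) (ha : a ∈ D x) (hb : b ∈ D' x) :
      ⟪covDerivEndo S x (a + b) (a + b), a + b⟫_ℝ =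
        d% p x a * ⟪a, a⟫_ℝ + d% q x b * ⟪b, b⟫_ℝ + d% p x b * ⟪a, a⟫_ℝ +
          (d% q x a - 2 * (p x - q x) * ⟪ξ x, a⟫_ℝ) * ⟪b, b⟫_ℝ := by
    rw [inner_covDerivEndo_add_self (hS x) hsymm, hua x a a ha, hub x b b hb, hua x b a ha,
      haab x a b ha hb, hub x a b hb, hbba x a b ha hb]
    ring
  constructor
  · intro hK
    have hpa (x : M) (a : TangentSpace I x) (ha : a ∈ D x) : d% p x a = 0 := by
      have h1 := hK.2 x a
      rw [hua x a a ha] at h1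
      rcases mul_eq_zero.1 h1 with h1 | h1
      · exact h1
      · rw [inner_self_eq_zero.1 h1, map_zero]
    have hqb (x : M) (b : TangentSpace I x) (hb : b ∈ D' x) : d% q x b = 0 := by
      have h1 := hK.2 x b
      rw [hub x b b hb] at h1
      rcases mul_eq_zero.1 h1 with h1 | h1
      · exact h1
      · rw [inner_self_eq_zero.1 h1, map_zero]
    have hmix (x : M) (a b : TangentSpace I x) (ha : a ∈ D x) (hb : b ∈ D' x) :
        d% p x b * ⟪a, a⟫_ℝ + (d% q x a - 2 * (p x - q x) * ⟪ξ x, a⟫_ℝ) * ⟪b, b⟫_ℝ = 0 := by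
      have h1 := hadd x a b ha hb
      rw [hK.2 x (a + b), hpa x a ha, hqb x b hb] at h1
      linarith
    -- Replacing `b` by `-b` separates the part odd in `b` from the even one.
    have hboth (x : M) (a b : TangentSpace I x) (ha : a ∈ D x) (hb : b ∈ D' x) :
        d% p x b * ⟪a, a⟫_ℝ = 0 ∧
          (d% q x a - 2 * (p x - q x) * ⟪ξ x, a⟫_ℝ) * ⟪b, b⟫_ℝ = 0 := by
      have h1 := hmix x a b ha hb
      have h2 := hmix x a (-b) ha (neg_mem hb)
      rw [map_neg, inner_neg_neg] at h2
      constructor <;> linarith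
    refine ⟨fun x ↦ ?_, hqb, fun x a ha ↦ ?_⟩
    · ext v
      obtain ⟨a, ha, b, hb, rfl⟩ := h.exists_add v
      obtain ⟨a', ha', hne⟩ := h.exists_ne_zero hd x
      have h1 := (mul_eq_zero.1 (hboth x a' b ha' hb).1).resolve_right
        (inner_self_ne_zero.2 hne)
      rw [map_add, hpa x a ha, h1, add_zero, zero_apply]
    · obtain ⟨b, hb, hne⟩ := h.symm.exists_ne_zero hd' x
      exact sub_eq_zero.1 ((mul_eq_zero.1 (hboth x a b ha hb).2).resolve_right
        (inner_self_ne_zero.2 hne))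
  · rintro ⟨h1, h2, h3⟩
    refine ⟨hsymm, fun x u ↦ ?_⟩
    obtain ⟨a, ha, b, hb, rfl⟩ := h.exists_add u
    rw [hadd x a b ha hb, h1 x, h2 x b hb, h3 x a ha]
    simp

/-- The three Killing equations for the eigenvalues `lam - κ` and `mu - κ`, rewritten through `dλ -
2dμ` and `dμ`; the equation involving `ξ` is supplied by the Bianchi identity. -/
theorem isGray_iff [I.Boundaryless] [PreconnectedSpace M] [Nonempty M]
    (h : IsRicciSplitting lam mu D D' 2 d') (hd' : 0 < d')
    (hgeod : IsTotallyGeodesicFoliation D) (humb : IsUmbilical D') :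
    IsGray I M ↔ (∃ c : ℝ, ∀ x, lam x - 2 * mu x = c) ∧
      ∀ x, grad I (scalarCurvature I) x ∈ D x := by
  obtain ⟨-, ξ, -, hξ⟩ := humb
  have hlam := h.smoothFunAt_left two_pos
  have hmu := h.symm.smoothFunAt_left hd'
  have hdim : (finrank ℝ E : ℝ) = 2 + d' := by rw [← h.rank_add]; push_cast; ring
  have hpos : (0 : ℝ) < d' := by exact_mod_cast hd'
  have hτ := fun x v ↦ h.mvfderiv_scalarCurvature (x := x) two_pos hd' v
  set κ : M → ℝ := fun x ↦ 2 / (finrank ℝ E + 2) * scalarCurvature I x with hκ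
  have hκs (x : M) : SmoothFunAt I κ x :=
    (SmoothFunAt.const _).mul (smoothFunAt_scalarCurvature x)
  have hdκ (x : M) (v : TangentSpace I x) :
      -- Here `dim M + 2 = d' + 4` and `τ = 2λ + d'μ`.
      d% κ x v = 2 / (d' + 4) * (2 * d% lam x v + d' * d% mu x v) := by
    have h1 := hτ x v
    rw [hκ, mvfderiv_fun_mul (SmoothFunAt.const _).mdiff (smoothFunAt_scalarCurvature x).mdiff]
    simp only [mvfderiv_const, smul_zero, add_zero, smul_apply, smul_eq_mul, h1, hdim]
    push_cast
    ring
  have hG : IsGray I M ↔ IsKillingTensor fun x : M ↦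
      ricciEndo (I := I) x - κ x • LinearMap.id := by
    have : (fun x : M ↦ ricciEndo (I := I) x - κ x • LinearMap.id) = fun x : M ↦
        ricciEndo (I := I) x - (2 * scalarCurvature I x / (finrank ℝ E + 2)) • LinearMap.id := by
      funext x
      simp only [hκ, div_mul_eq_mul_div]
    rw [this, IsGray]
  rw [hG, h.isKillingTensor_iff two_pos hd' hgeod hξ (p := fun x ↦ lam x - κ x)
    (q := fun x ↦ mu x - κ x) (fun x V hV ↦ hV.ricciEndo.sub (SmoothAt.smul (hκs x) hV))
    (fun y v w ↦ by simp [inner_sub_left, inner_sub_right, inner_smul_left, inner_smul_right,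
      ricciEndo_isSymmetric])
    (fun x ↦ (hlam x).sub (hκs x)) (fun x ↦ (hmu x).sub (hκs x))
    (fun x v hv ↦ by simp [h.left x v hv, sub_smul])
    (fun x v hv ↦ by simp [h.right x v hv, sub_smul])]
  have hdp (x : M) (v : TangentSpace I x) : d% (fun x ↦ lam x - κ x) x v =
      d' / (d' + 4) * (d% lam x v - 2 * d% mu x v) := by
    rw [mvfderiv_fun_sub (hlam x).mdiff (hκs x).mdiff, sub_apply, hdκ]
    field_simp
    ring
  -- Written so that only `-dμ` survives once `dλ = 2dμ`.
  have hdq (x : M) (v : TangentSpace I x) : d% (fun x ↦ mu x - κ x) x v =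
      -d% mu x v - 4 / (d' + 4) * (d% lam x v - 2 * d% mu x v) := by
    rw [mvfderiv_fun_sub (hmu x).mdiff (hκs x).mdiff, sub_apply, hdκ]
    field_simp
    ring
  have hbianchi (x : M) (a : TangentSpace I x) (ha : a ∈ D x) :=
    h.mvfderiv_right_of_isUmbilical rfl hd' hξ ha
  have hdl (x : M) (v : TangentSpace I x) : d% (fun x ↦ lam x - 2 * mu x) x v =
      d% lam x v - 2 * d% mu x v := by
    rw [mvfderiv_fun_sub (hlam x).mdiff ((SmoothFunAt.const 2).mul (hmu x)).mdiff,
      mvfderiv_fun_mul (SmoothFunAt.const 2).mdiff (hmu x).mdiff]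
    simp [mvfderiv_const]
  have hne : (d' : ℝ) / (d' + 4) ≠ 0 := by positivity
  constructor
  · rintro ⟨h1, h2, -⟩
    have h4 (x : M) (v : TangentSpace I x) : d% lam x v - 2 * d% mu x v = 0 := by
      have h5 := hdp x v
      rw [h1 x, zero_apply] at h5
      exact (mul_eq_zero.1 h5.symm).resolve_left hne
    refine ⟨?_, fun x ↦ h.mem_left_of_inner_eq_zero fun b hb ↦ ?_⟩
    · have hloc : IsLocallyConstant fun x ↦ lam x - 2 * mu x :=
        isLocallyConstant_of_mvfderiv_eq_zero (I := I)
          (fun x ↦ ((hlam x).sub ((SmoothFunAt.const 2).mul (hmu x))).mdiff)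
          (fun x ↦ by ext v; rw [hdl, h4, zero_apply])
      let x₀ : M := Classical.arbitrary M
      exact ⟨lam x₀ - 2 * mu x₀, fun x ↦ hloc.apply_eq_of_preconnectedSpace x x₀⟩
    · have h5 := hdq x b
      rw [h2 x b hb, h4, mul_zero, sub_zero] at h5
      have h6 := h4 x b
      rw [inner_grad, hτ]
      push_cast
      have h7 : d% mu x b = 0 := by linarith
      rw [h7] at h6 ⊢
      linarith
  · rintro ⟨⟨c, hc⟩, hgrad⟩
    have h4 (x : M) (v : TangentSpace I x) : d% lam x v - 2 * d% mu x v = 0 := by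
      rw [← hdl, funext hc, mvfderiv_const, zero_apply]
    refine ⟨fun x ↦ ?_, fun x b hb ↦ ?_, fun x a ha ↦ ?_⟩
    · ext v
      rw [hdp, h4, mul_zero, zero_apply]
    · have h5 := h.inner_eq_zero (hgrad x) hb
      rw [inner_grad, hτ] at h5
      push_cast at h5
      have h6 := h4 x b
      -- With `dλ = 2dμ`, the differential `dτ = 2dλ + d'dμ` is `(4 + d') dμ`.
      have h7 : (4 + d') * d% mu x b = 0 := by linarith
      have h8 : d% mu x b = 0 := (mul_eq_zero.1 h7).resolve_left (by positivity)
      rw [hdq, h4, h8]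
      simp
    -- Since `dq = -dμ` and `p - q = λ - μ`, this is exactly the Bianchi relation.
    · rw [hdq, h4, hbianchi x a ha]
      ring

end IsRicciSplitting

end Gray

end GrayManifold
end

/-- A `2n`-dimensional Riemannian manifold whose Ricci tensor has two eigenvalues `lam`, `mu` of
multiplicities `2` and `2(n-1)`, the first eigendistribution being a totally geodesic foliation and
the second one umbilical, is Gray iff `lam - 2 mu` is constant and `∇τ` lies in the first one. -/
theorem proposition1 (n : ℕ) (hn : 2 ≤ n)
    {M : Type*} [TopologicalSpace M] [T2Space M] [ConnectedSpace M]
    [ChartedSpace (EuclideanSpace ℝ (Fin (2 * n))) M] [IsManifold (𝓡 (2 * n)) ∞ M]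
    [RiemannianBundle (fun x : M ↦ TangentSpace (𝓡 (2 * n)) x)]
    [IsContMDiffRiemannianBundle (𝓡 (2 * n)) ∞ (EuclideanSpace ℝ (Fin (2 * n)))
      (fun x : M ↦ TangentSpace (𝓡 (2 * n)) x)]
    (lam mu : M → ℝ) (D D' : Π x : M, Submodule ℝ (TangentSpace (𝓡 (2 * n)) x))
    (hne : ∀ x, lam x ≠ mu x)
    (hD : ∀ x, D x = Module.End.eigenspace (GrayManifold.ricciEndo x) (lam x))
    (hD' : ∀ x, D' x = Module.End.eigenspace (GrayManifold.ricciEndo x) (mu x))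
    (hrank : ∀ x, Module.finrank ℝ (D x) = 2)
    (hrank' : ∀ x, Module.finrank ℝ (D' x) = 2 * (n - 1))
    (hgeod : GrayManifold.IsTotallyGeodesicFoliation D)
    (humb : GrayManifold.IsUmbilical D') :
    GrayManifold.IsGray (𝓡 (2 * n)) M ↔
      (∃ c : ℝ, ∀ x, lam x - 2 * mu x = c) ∧
        ∀ x, GrayManifold.grad (𝓡 (2 * n)) (GrayManifold.scalarCurvature (𝓡 (2 * n))) x ∈ D x := by
  have h : GrayManifold.IsRicciSplitting lam mu D D' 2 (2 * (n - 1)) :=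
    ⟨hne, fun x v hv ↦ Module.End.mem_eigenspace_iff.1 (hD x ▸ hv),
      fun x v hv ↦ Module.End.mem_eigenspace_iff.1 (hD' x ▸ hv), hrank, hrank',
      by rw [finrank_euclideanSpace_fin]; omega, hgeod.1, humb.1⟩
  exact h.isGray_iff (by omega) hgeod humb
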